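/- Let $M$ be a smooth toric variety of complex dimension $n$, i.e. a (Hausdorff) $n$-dimensional complex manifold with an effective holomorphic action of $(\mathbb{C}^*)^n$ that has a dense open orbit. Let $M$ be endowed with a Kähler metric $g$, with Kähler form $\omega$, such that the action of the compact torus $\mathbb{T}^n\subset(\mathbb{C}^*)^n$ is Hamiltonian: there is a smooth $\mathbb{T}^n$-invariant map $\mu:M\to(\mathbb{R}^n)^*$ with $d\mu\cdot X=\omega(\tilde X,\cdot)$ for all $X\in\mathbb{R}^n=\mathrm{Lie}(\mathbb{T}^n)$, where $\tilde X$ is the fundamental vector field of $X$. Let $\mathrm{Ric}$ be the Ricci curvature of $g$. Fix a point $p_0$ of the open orbit, identify the open orbit with $(\mathbb{C}^*)^n\simeq\mathbb{C}^n/2\pi i\mathbb{Z}^n$ through $z=x+iy\mapsto \exp(z)\,p_0$, and let $\mathrm{Vol}(x)$, $x\in\mathbb{R}^n$, be the Riemannian $n$-volume of the $\mathbb{T}^n$-orbit of $\exp(x)\,p_0$. A $C^2$ function on $\mathbb{R}^n$ is called strictly convex (strictly concave) here if its Hessian is positive (negative) definite at every point. Then $\mathrm{Vol}$ is a smooth positive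 function on $\mathbb{R}^n$, and: 1. $\mathrm{Ric}>0$ on the open orbit if and only if $\log\mathrm{Vol}$ is strictly concave. In this case $1/\mathrm{Vol}$ is strictly convex and, if $M$ is compact, $\mathrm{Vol}$ has a unique critical point $x_0\in\mathbb{R}^n$. At $x_0$ the volume is maximal among all $\mathbb{T}^n$-orbits in $M$ (where the $n$-volume of a lower-dimensional orbit is $0$), and the $\mathbb{T}^n$-orbit of $\exp(x_0)\,p_0$ is an embedded minimal Lagrangian $n$-torus, minimal meaning that it is a critical point of the Riemannian volume with respect to all smooth variations through maps $\mathbb{T}^n\to M$. 2. $\mathrm{Ric}<0$ on the open orbit if and only if $\log\mathrm{Vol}$ is strictly convex. In this case $\mathrm{Vol}$ is strictly convex and, if $n\geq 1$, $M$ is not compact. -/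

import Mathlib

set_option maxSynthPendingDepth 3

open scoped Manifold ContDiff

noncomputable section

/-! ### The complex torus, the real torus and toric manifolds -/

/-- The model space `ℂⁿ` (also used as a real vector space of dimension `2n`). -/
abbrev Cn (n : ℕ) : Type := Fin n → ℂ

/-- The complex Lie group `(ℂ*)ⁿ`. -/
abbrev ComplexTorus (n : ℕ) : Type := Fin n → ℂˣ

/-- The universal covering homomorphism `exp : ℂⁿ → (ℂ*)ⁿ`, with kernel `2πiℤⁿ`. -/
def torusExp {n : ℕ} (w : Cn n) : ComplexTorus n :=
  fun i => Units.mk0 (Complex.exp (w i)) (Complex.exp_ne_zero (w i))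

/-- `x ↦ exp x` for `x ∈ ℝⁿ`: the element of `(ℂ*)ⁿ` with moduli `r_i = exp x_i`, arguments `0`. -/
def expReal {n : ℕ} (x : Fin n → ℝ) : ComplexTorus n :=
  torusExp fun i => (x i : ℂ)

/-- `y ↦ (exp (i y_1), …, exp (i y_n))` for `y ∈ ℝⁿ`: the covering `ℝⁿ → 𝕋ⁿ = (S¹)ⁿ ⊆ (ℂ*)ⁿ`. -/
def expImag {n : ℕ} (y : Fin n → ℝ) : ComplexTorus n :=
  torusExp fun i => (y i : ℂ) * Complex.I

/-- A complex manifold is a real smooth manifold. -/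
instance isManifold_real_of_complex {n : ℕ} {M : Type*} [TopologicalSpace M]
    [ChartedSpace (Cn n) M] [h : IsManifold 𝓘(ℂ, Cn n) ω M] : IsManifold 𝓘(ℝ, Cn n) ∞ M := by
  refine isManifold_of_contDiffOn _ _ _ fun e e' he he' => ?_
  have h1 := (contDiffGroupoid ω 𝓘(ℂ, Cn n)).compatible he he'
  rw [contDiffGroupoid, mem_groupoid_of_pregroupoid] at h1
  exact (ContDiffOn.restrict_scalars ℝ h1.1).of_le le_top

/-- An `n`-dimensional complex manifold `M` with an action of `(ℂ*)ⁿ` is a (smooth) toric variety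
if the action is holomorphic, effective, and has a dense open orbit.  Since `torusExp` is a
surjective local biholomorphism, holomorphy of the action map `(ℂ*)ⁿ × M → M` is holomorphy of its
composition with `torusExp × id`. -/
structure IsToric (n : ℕ) (M : Type*) [TopologicalSpace M] [ChartedSpace (Cn n) M]
    [MulAction (ComplexTorus n) M] : Prop where
  holomorphic : ContMDiff (𝓘(ℂ, Cn n).prod 𝓘(ℂ, Cn n)) 𝓘(ℂ, Cn n) ω
    (fun q : Cn n × M => torusExp q.1 • q.2)
  effective : FaithfulSMul (ComplexTorus n) M
  exists_dense_open_orbit : ∃ p : M, IsOpen (MulAction.orbit (ComplexTorus n) p) ∧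
    Dense (MulAction.orbit (ComplexTorus n) p)

/-! ### Riemannian metrics and Ricci curvature in a normed space -/

section Local

variable {E : Type*} [NormedAddCommGroup E] [NormedSpace ℝ E]

/-- The Christoffel symbols of the first kind:
`koszul G x u v w = ½ ((∂_u G)(v, w) + (∂_v G)(u, w) - (∂_w G)(u, v))` at `x`. -/
def koszul (G : E → (E →L[ℝ] E →L[ℝ] ℝ)) (x : E) :
    E →L[ℝ] E →L[ℝ] E →L[ℝ] ℝ :=
  let D : E →L[ℝ] E →L[ℝ] E →L[ℝ] ℝ := fderiv ℝ G x
  let D' : E →L[ℝ] E →L[ℝ] E →L[ℝ] ℝ :=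
    (ContinuousLinearMap.flipₗᵢ ℝ E E ℝ).toLinearIsometry.toContinuousLinearMap ∘L D.flip
  (1 / 2 : ℝ) • (D + D.flip - D')

theorem koszul_apply (G : E → (E →L[ℝ] E →L[ℝ] ℝ)) (x u v w : E) :
    koszul G x u v w =
      1 / 2 * (fderiv ℝ G x u v w + fderiv ℝ G x v u w - fderiv ℝ G x w u v) :=
  rfl

/-- The Christoffel symbols `Γ_x(u, v)` of the Levi-Civita connection of the metric `G`, defined by
`G_x(Γ_x(u, v), w) = koszul G x u v w`: the index is raised with the inverse of
`G_x : E → E*`. -/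
def christoffel (G : E → (E →L[ℝ] E →L[ℝ] ℝ)) (x : E) :
    E →L[ℝ] E →L[ℝ] E :=
  (ContinuousLinearMap.compL ℝ E (E →L[ℝ] ℝ) E
    (ContinuousLinearMap.inverse (G x))) ∘L koszul G x

/-- The Riemann curvature as the endomorphism `u ↦ R(u, v) w` at `x`, where
`R(u, v) w = (∂_u Γ)(v, w) - (∂_v Γ)(u, w) + Γ(u, Γ(v, w)) - Γ(v, Γ(u, w))`. -/
def riemannCurv (G : E → (E →L[ℝ] E →L[ℝ] ℝ)) (x v w : E) :
    E →L[ℝ] E :=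
  ((fderiv ℝ (christoffel G) x).flip v).flip w - (fderiv ℝ (christoffel G) x v).flip w
    + (christoffel G x).flip (christoffel G x v w)
    - (christoffel G x v) ∘L ((christoffel G x).flip w)

theorem riemannCurv_apply (G : E → (E →L[ℝ] E →L[ℝ] ℝ)) (x u v w : E) :
    riemannCurv G x v w u =
      fderiv ℝ (christoffel G) x u v w - fderiv ℝ (christoffel G) x v u w
        + christoffel G x u (christoffel G x v w) - christoffel G x v (christoffel G x u w) :=
  rfl

/-- The Ricci tensor `Ric(v, w) = tr (u ↦ R(u, v) w)` (real trace) of the metric `G` at `x`. -/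
def localRicci (G : E → (E →L[ℝ] E →L[ℝ] ℝ)) (x v w : E) : ℝ :=
  LinearMap.trace ℝ E (riemannCurv G x v w : E →ₗ[ℝ] E)

end Local

/-! ### Differentials, orbits and fundamental vector fields -/

/-- The real differential `dF_x` of a map `F` from a real normed space into `M`; as everywhere in
Mathlib, `T_p M` is identified with the model space `ℂⁿ` through the preferred chart at `p`. -/
def diffAt {n : ℕ} {M : Type*} [TopologicalSpace M] [ChartedSpace (Cn n) M]
    {W : Type*} [NormedAddCommGroup W] [NormedSpace ℝ W] (F : W → M) (x : W) : W →L[ℝ] Cn n :=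
  mfderiv 𝓘(ℝ, W) 𝓘(ℝ, Cn n) F x

/-- The real differential `dμ_p` of a map `μ : M → (ℝⁿ)*`. -/
def momentDiffAt {n : ℕ} {M : Type*} [TopologicalSpace M] [ChartedSpace (Cn n) M]
    (μ : M → ((Fin n → ℝ) →L[ℝ] ℝ)) (p : M) : Cn n →L[ℝ] ((Fin n → ℝ) →L[ℝ] ℝ) :=
  mfderiv 𝓘(ℝ, Cn n) 𝓘(ℝ, (Fin n → ℝ) →L[ℝ] ℝ) μ p

/-- The inverse of the preferred chart at `p` (meaningful on the target of that chart). -/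
def chartInv {n : ℕ} {M : Type*} [TopologicalSpace M] [ChartedSpace (Cn n) M] (p : M) :
    Cn n → M :=
  (extChartAt 𝓘(ℝ, Cn n) p).symm

/-- A map `ℝⁿ → M` descends to `𝕋ⁿ = ℝⁿ/2πℤⁿ`. -/
def IsPeriodic {n : ℕ} {M : Type*} (F : (Fin n → ℝ) → M) : Prop :=
  ∀ (y : Fin n → ℝ) (k : Fin n → ℤ), F (fun i => y i + 2 * Real.pi * (k i : ℝ)) = F y

/-- The parametrization `y ↦ exp(iy) p` of the `𝕋ⁿ`-orbit of `p`. -/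
def orbitMap {n : ℕ} {M : Type*} [MulAction (ComplexTorus n) M] (p : M) (y : Fin n → ℝ) : M :=
  expImag y • p

/-- The fundamental vector field `X̃(p) = d/ds|_{s=0} exp(sX) p` of `X ∈ ℝⁿ = Lie(𝕋ⁿ)`. -/
def fundamentalField {n : ℕ} {M : Type*} [TopologicalSpace M] [ChartedSpace (Cn n) M]
    [MulAction (ComplexTorus n) M] (X : Fin n → ℝ) (p : M) : Cn n :=
  diffAt (fun s : ℝ => expImag (s • X) • p) 0 1

/-! ### Kähler metrics on complex manifolds -/

section Metric

variable {n : ℕ} {M : Type*} [TopologicalSpace M] [ChartedSpace (Cn n) M]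
  [IsManifold 𝓘(ℂ, Cn n) ω M]

variable (n M) in
/-- Smooth Riemannian metrics on (the real manifold underlying) `M`. -/
abbrev RiemMetric : Type _ :=
  Bundle.ContMDiffRiemannianMetric 𝓘(ℝ, Cn n) ∞ (Cn n)
    (fun p : M => TangentSpace 𝓘(ℝ, Cn n) p)

/-- The scalar product on `T_p M`; as everywhere in Mathlib, `T_p M` is identified with the model
space `ℂⁿ` through the preferred chart at `p`. -/
def metricAt (g : RiemMetric n M) (p : M) : Cn n →L[ℝ] Cn n →L[ℝ] ℝ := g.inner p

/-- The two-form `ω(u, v) = g(Ju, v)` on `T_p M`, where `J` is multiplication by `i`.  (The charts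
are holomorphic, so the complex structure of `T_p M` is that of the model space.) -/
def kahlerForm (g : RiemMetric n M) (p : M) (u v : Cn n) : ℝ :=
  metricAt g p (Complex.I • u) v

/-- The pull-back `F^* g` of the metric by a map `F` from a normed space into `M`. -/
def pullbackMetric {W : Type*} [NormedAddCommGroup W] [NormedSpace ℝ W]
    (g : RiemMetric n M) (F : W → M) (x : W) : W →L[ℝ] W →L[ℝ] ℝ :=
  (metricAt g (F x)).bilinearComp (diffAt F x) (diffAt F x)

/-- The pull-back `F^* ω` of the Kähler form by a map `F` from a normed space into `M`. -/
def pullbackForm {W : Type*} [NormedAddCommGroup W] [NormedSpace ℝ W]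
    (g : RiemMetric n M) (F : W → M) (x u v : W) : ℝ :=
  kahlerForm g (F x) (diffAt F x u) (diffAt F x v)

/-- A Riemannian metric on a complex manifold is Kähler if `J` is an isometry and the two-form
`ω = g(J·, ·)` is closed.  Closedness `dω(u, v, w) = 0` is written in all preferred charts, for
constant vector fields `u, v, w`. -/
structure IsKahler (g : RiemMetric n M) : Prop where
  isometry_J : ∀ (p : M) (u v : Cn n),
    metricAt g p (Complex.I • u) (Complex.I • v) = metricAt g p u v
  closed : ∀ p : M, ∀ x ∈ (extChartAt 𝓘(ℝ, Cn n) p).target, ∀ u v w : Cn n,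
    fderiv ℝ (fun x' => pullbackForm g (chartInv p) x' v w) x u
      + fderiv ℝ (fun x' => pullbackForm g (chartInv p) x' w u) x v
      + fderiv ℝ (fun x' => pullbackForm g (chartInv p) x' u v) x w = 0

/-- The Ricci tensor of `g` at `p`, computed in the preferred chart at `p`, through which `T_p M` is
identified with `ℂⁿ`. -/
def ricci (g : RiemMetric n M) (p : M) (u v : Cn n) : ℝ :=
  localRicci (pullbackMetric g (chartInv p)) (extChartAt 𝓘(ℝ, Cn n) p p) u v

/-- `Ric > 0` at all points of `S`. -/
def RicciPositiveOn (g : RiemMetric n M) (S : Set M) : Prop :=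
  ∀ p ∈ S, ∀ u : Cn n, u ≠ 0 → 0 < ricci g p u u

/-- `Ric < 0` at all points of `S`. -/
def RicciNegativeOn (g : RiemMetric n M) (S : Set M) : Prop :=
  ∀ p ∈ S, ∀ u : Cn n, u ≠ 0 → ricci g p u u < 0

/-! ### Hamiltonian torus actions -/

/-- `μ : M → (ℝⁿ)*` is a moment map of the `𝕋ⁿ`-action: it is smooth, `dμ · X = ω(X̃, ·)`, and it is
equivariant (i.e. invariant, because the coadjoint action of `𝕋ⁿ` is trivial). -/
structure IsMomentMap [MulAction (ComplexTorus n) M] (g : RiemMetric n M)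
    (μ : M → ((Fin n → ℝ) →L[ℝ] ℝ)) : Prop where
  smooth : ContMDiff 𝓘(ℝ, Cn n) 𝓘(ℝ, (Fin n → ℝ) →L[ℝ] ℝ) ∞ μ
  deriv_eq : ∀ (p : M) (X : Fin n → ℝ) (u : Cn n),
    momentDiffAt μ p u X = kahlerForm g p (fundamentalField X p) u
  equivariant : ∀ (y : Fin n → ℝ) (p : M), μ (expImag y • p) = μ p

/-- The `𝕋ⁿ`-action is Hamiltonian: it has a moment map. -/
def IsHamiltonian [MulAction (ComplexTorus n) M] (g : RiemMetric n M) : Prop :=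
  ∃ μ : M → ((Fin n → ℝ) →L[ℝ] ℝ), IsMomentMap g μ

/-! ### Volume, Lagrangian and minimal tori -/

/-- The Riemannian `n`-volume `∫_{𝕋ⁿ} √det (F^* g)(∂_{y_i}, ∂_{y_j}) dy` of a map `F : 𝕋ⁿ → M`, given
by its lift to `ℝⁿ`.  If `F` is an embedding, this is the volume of its image. -/
def torusVolume (g : RiemMetric n M) (F : (Fin n → ℝ) → M) : ℝ :=
  ∫ y in Set.Icc (0 : Fin n → ℝ) (fun _ => 2 * Real.pi),
    Real.sqrt (Matrix.det (Matrix.of fun i j : Fin n =>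
      pullbackMetric g F y (Pi.single i 1) (Pi.single j 1)))

/-- `F` parametrizes an embedded Lagrangian `n`-torus: it is a smooth `2πℤⁿ`-periodic immersion,
injective on `𝕋ⁿ = ℝⁿ/2πℤⁿ`, with `F^* ω = 0`. -/
structure IsLagrangianTorus (g : RiemMetric n M) (F : (Fin n → ℝ) → M) : Prop where
  smooth : ContMDiff 𝓘(ℝ, Fin n → ℝ) 𝓘(ℝ, Cn n) ∞ F
  periodic : IsPeriodic F
  injective : ∀ y y' : Fin n → ℝ, F y = F y' →
    ∃ k : Fin n → ℤ, y' = fun i => y i + 2 * Real.pi * (k i : ℝ)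
  immersion : ∀ y : Fin n → ℝ, Function.Injective (diffAt (n := n) F y)
  lagrangian : ∀ y u v : Fin n → ℝ, pullbackForm g F y u v = 0

/-- `F` parametrizes a minimal torus: it is a critical point of the volume functional, with respect
to all smooth variations `(F_t)`, `t ∈ ℝ`, through maps `𝕋ⁿ → M`. -/
def IsMinimalTorus (g : RiemMetric n M) (F : (Fin n → ℝ) → M) : Prop :=
  ∀ Φ : ℝ × (Fin n → ℝ) → M,
    ContMDiff 𝓘(ℝ, ℝ × (Fin n → ℝ)) 𝓘(ℝ, Cn n) ∞ Φ →
    (∀ t : ℝ, IsPeriodic fun y => Φ (t, y)) →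
    (∀ y, Φ (0, y) = F y) →
    HasDerivAt (fun t : ℝ => torusVolume g fun y => Φ (t, y)) 0 0

/-- The volume of the `𝕋ⁿ`-orbits in the orbit `(ℂ*)ⁿ p₀`, as a function of the logarithmic
coordinates `x ∈ ℝⁿ`, `x_i = log r_i`: the volume of the orbit `𝕋ⁿ · (exp x) p₀`. -/
def orbitVolume [MulAction (ComplexTorus n) M] (g : RiemMetric n M) (p₀ : M)
    (x : Fin n → ℝ) : ℝ :=
  torusVolume g (orbitMap (expReal x • p₀))

end Metric

/-- A function on `ℝⁿ` is strictly convex in the differential sense: it is `C²`, with positive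
definite Hessian everywhere. -/
def HessStrictlyConvex {n : ℕ} (f : (Fin n → ℝ) → ℝ) : Prop :=
  ContDiff ℝ 2 f ∧ ∀ x u : Fin n → ℝ, u ≠ 0 → 0 < fderiv ℝ (fderiv ℝ f) x u u

/-- A function on `ℝⁿ` is strictly concave in the differential sense: it is `C²`, with negative
definite Hessian everywhere. -/
def HessStrictlyConcave {n : ℕ} (f : (Fin n → ℝ) → ℝ) : Prop :=
  ContDiff ℝ 2 f ∧ ∀ x u : Fin n → ℝ, u ≠ 0 → fderiv ℝ (fderiv ℝ f) x u u < 0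

end

/-! On the open orbit use the logarithmic coordinates z = x + iy. Invariance makes the moment map a
function of x alone, the moment map equation says that the x-derivative of the moment map is minus
the metric on real directions, and J carries this to the imaginary directions. So the metric is the
tube metric of h = -dμ, that is h(Re, Re) + h(Im, Im) (`pullbackMetric_expOrbit`). As h is symmetric
and is itself a derivative, its derivative is totally symmetric: h is a Hessian metric
(`isHessianMetric`).

For such an h the Christoffel symbol Γ is half the derivative of h with an index raised, and the
Christoffel symbol of the tube metric is its complex bilinear extension. The curvature trace then
collapses to the Kähler formula Ric = -Hess (½ log det h), applied to real and imaginary parts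
(`localRicci_tubeMetric`). On the other hand the induced metric on each torus orbit is constant in
y, so Vol = (2π)^n √det h. Hence Ric is minus the Hessian of log Vol, which gives both equivalences,
and Hess (C e^f) = C e^f (df² + Hess f) gives the convexity of 1/Vol or Vol.

If M is compact, det h, defined on all of M and vanishing off the open orbit, is continuous and
attains its maximum; a point where it is nonzero has an open orbit, so it lies in the dense one
(`exists_forall_torusVolume_le`). Strict concavity makes the critical point unique, whereas strict
convexity excludes a maximum.

For minimality, a variation of a critical orbit lifts for small t to Z(t, y) in the tube with Z(0,
y) = iy. The derivative of the volume density is √det h times the derivative of log Vol along Re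
∂Z/∂t, which is zero, plus the divergence of Im ∂Z/∂t, which integrates to zero over a period
(`hasDerivAt_integral_sqrt_det_gramAlong`). -/

set_option linter.unusedSectionVars false

/-! ### Naturality of Christoffel symbols and Ricci curvature under changes of coordinates. -/

section LocalGeometry

open scoped Topology

variable {E : Type*} [NormedAddCommGroup E] [NormedSpace ℝ E] [FiniteDimensional ℝ E]

theorem ContinuousLinearMap.isInvertible_of_injective {E' : Type*} [NormedAddCommGroup E']
    [NormedSpace ℝ E'] [FiniteDimensional ℝ E'] (B : E →L[ℝ] E')
    (hd : Module.finrank ℝ E = Module.finrank ℝ E') (hB : ∀ u, B u = 0 → u = 0) :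
    B.IsInvertible := by
  have hinj : Function.Injective (B : E →ₗ[ℝ] E') := by
    rw [← LinearMap.ker_eq_bot, LinearMap.ker_eq_bot']
    exact hB
  exact ⟨(LinearEquiv.ofInjectiveOfFinrankEq (B : E →ₗ[ℝ] E') hinj hd).toContinuousLinearEquiv,
    by ext x; rfl⟩

theorem isInvertible_of_posDef (B : E →L[ℝ] E →L[ℝ] ℝ) (hB : ∀ u, u ≠ 0 → 0 < B u u) :
    B.IsInvertible := by
  refine B.isInvertible_of_injective ?_ fun u hu => ?_
  · have h1 : Module.finrank ℝ (E →L[ℝ] ℝ) = Module.finrank ℝ (E →ₗ[ℝ] ℝ) :=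
      (LinearMap.toContinuousLinearMap (𝕜 := ℝ) (E := E) (F' := ℝ)).finrank_eq.symm
    rw [h1]
    exact (Subspace.dual_finrank_eq (K := ℝ) (V := E)).symm
  · by_contra h
    have := hB u h
    simp [hu] at this

theorem metric_christoffel {G : E → (E →L[ℝ] E →L[ℝ] ℝ)} {x : E}
    (hG : (G x).IsInvertible) (u v w : E) :
    G x (christoffel G x u v) w = koszul G x u v w := by
  have : G x (christoffel G x u v) = koszul G x u v := by
    simp only [christoffel, ContinuousLinearMap.comp_apply, ContinuousLinearMap.compL_apply]
    exact hG.self_apply_inverse _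
  rw [this]

theorem christoffel_eq_of_metric_eq {G : E → (E →L[ℝ] E →L[ℝ] ℝ)} {x : E}
    (hG : (G x).IsInvertible) {u v y : E} (h : ∀ w, G x y w = koszul G x u v w) :
    christoffel G x u v = y :=
  hG.injective (ContinuousLinearMap.ext fun w => by rw [metric_christoffel hG, h])

theorem ContDiffAt.koszul {G : E → (E →L[ℝ] E →L[ℝ] ℝ)} {x : E} {m k : ℕ∞ω}
    (hG : ContDiffAt ℝ k G x) (hk : m + 1 ≤ k) : ContDiffAt ℝ m (koszul G) x := by
  have hD : ContDiffAt ℝ m (fderiv ℝ G) x := hG.fderiv_right hk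
  unfold _root_.koszul
  have hf : ContDiffAt ℝ m (fun x => (fderiv ℝ G x).flip) x :=
    (ContinuousLinearMap.flipₗᵢ ℝ E E (E →L[ℝ] ℝ)).contDiff.contDiffAt.comp x hD
  exact ContDiffAt.const_smul _ ((hD.add hf).sub (contDiffAt_const.clm_comp hf))

theorem ContDiffAt.christoffel {G : E → (E →L[ℝ] E →L[ℝ] ℝ)} {x : E} {m k : ℕ∞ω}
    (hG : ContDiffAt ℝ k G x) (hk : m + 1 ≤ k) (hi : (G x).IsInvertible) :
    ContDiffAt ℝ m (christoffel G) x := by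
  have h1 : ContDiffAt ℝ m (fun y => ContinuousLinearMap.inverse (G y)) x :=
    hi.contDiffAt_map_inverse.comp x (hG.of_le (le_self_add.trans hk))
  unfold _root_.christoffel
  exact ((ContinuousLinearMap.compL ℝ E (E →L[ℝ] ℝ) E).contDiff.contDiffAt.comp x h1).clm_comp
    (hG.koszul hk)

theorem ContDiffAt.bilinearComp {E' : Type*} [NormedAddCommGroup E'] [NormedSpace ℝ E']
    {B : E → (E' →L[ℝ] E' →L[ℝ] ℝ)} {P : E → (E →L[ℝ] E')} {x : E}
    {k : ℕ∞ω} (hB : ContDiffAt ℝ k B x) (hP : ContDiffAt ℝ k P x) :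
    ContDiffAt ℝ k (fun y => (B y).bilinearComp (P y) (P y)) x := by
  unfold ContinuousLinearMap.bilinearComp
  have h1 := (ContinuousLinearMap.flipₗᵢ ℝ E E' ℝ).contDiff.contDiffAt.comp x (hB.clm_comp hP)
  exact (ContinuousLinearMap.flipₗᵢ ℝ E E ℝ).contDiff.contDiffAt.comp x (h1.clm_comp hP)

theorem fderiv_pullback_apply {G G' : E → (E →L[ℝ] E →L[ℝ] ℝ)} {ψ : E → E} {x : E}
    (hG : DifferentiableAt ℝ G (ψ x)) (hψ : ContDiffAt ℝ 2 ψ x)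
    (h : ∀ᶠ y in 𝓝 x, G' y = (G (ψ y)).bilinearComp (fderiv ℝ ψ y) (fderiv ℝ ψ y))
    (hG' : DifferentiableAt ℝ G' x) (u v w : E) :
    fderiv ℝ G' x u v w =
      fderiv ℝ G (ψ x) (fderiv ℝ ψ x u) (fderiv ℝ ψ x v) (fderiv ℝ ψ x w)
        + G (ψ x) (fderiv ℝ (fderiv ℝ ψ) x u v) (fderiv ℝ ψ x w)
        + G (ψ x) (fderiv ℝ ψ x v) (fderiv ℝ (fderiv ℝ ψ) x u w) := by
  have hD : HasFDerivAt (fderiv ℝ ψ) (fderiv ℝ (fderiv ℝ ψ) x) x :=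
    ((hψ.fderiv_right (m := 1) (by norm_num)).differentiableAt (by norm_num)).hasFDerivAt
  have hψ' : HasFDerivAt ψ (fderiv ℝ ψ x) x := (hψ.differentiableAt (by norm_num)).hasFDerivAt
  have h1 := (hG'.hasFDerivAt.clm_apply (hasFDerivAt_const v x)).clm_apply (hasFDerivAt_const w x)
  have h2 := ((hG.hasFDerivAt.comp x hψ').clm_apply
    (hD.clm_apply (hasFDerivAt_const v x))).clm_apply (hD.clm_apply (hasFDerivAt_const w x))
  have h3 := h2.congr_of_eventuallyEq (f₁ := fun y => G' y v w) (h.mono fun y hy => by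
    simp [hy])
  have h4 := congrArg (fun L => L u) (h1.unique h3)
  simp at h4
  rw [h4]
  ring

/-- Christoffel symbols transform with a second-derivative term. In the Koszul combination of the
three product rules, symmetry of the second derivative of ψ and of the metric cancels all such terms
but one pair, which adds up to the term shown. -/
theorem christoffel_pullback {G G' : E → (E →L[ℝ] E →L[ℝ] ℝ)} {ψ : E → E} {x : E}
    (hG : ContDiffAt ℝ 1 G (ψ x)) (hsymm : ∀ u v, G (ψ x) u v = G (ψ x) v u)
    (hpos : ∀ u, u ≠ 0 → 0 < G (ψ x) u u) (hψ : ContDiffAt ℝ 2 ψ x)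
    (hP : (fderiv ℝ ψ x).IsInvertible)
    (h : ∀ᶠ y in 𝓝 x, G' y = (G (ψ y)).bilinearComp (fderiv ℝ ψ y) (fderiv ℝ ψ y)) (u v : E) :
    fderiv ℝ ψ x (christoffel G' x u v) =
      christoffel G (ψ x) (fderiv ℝ ψ x u) (fderiv ℝ ψ x v) + fderiv ℝ (fderiv ℝ ψ) x u v := by
  have hi := isInvertible_of_posDef _ hpos
  have hx := h.self_of_nhds
  have hpos' : ∀ u, u ≠ 0 → 0 < G' x u u := fun u hu => by
    rw [hx]
    exact hpos _ fun h0 => hu (hP.injective (by simpa using h0))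
  have hG' : DifferentiableAt ℝ G' x := by
    have := ContDiffAt.bilinearComp (hG.comp x (hψ.of_le (by norm_num)))
      (hψ.fderiv_right (m := 1) (by norm_num))
    exact (this.differentiableAt (by norm_num)).congr_of_eventuallyEq h
  have hs : IsSymmSndFDerivAt ℝ ψ x := hψ.isSymmSndFDerivAt (by simp)
  set y := christoffel G (ψ x) (fderiv ℝ ψ x u) (fderiv ℝ ψ x v) + fderiv ℝ (fderiv ℝ ψ) x u v
    with hy
  have key : christoffel G' x u v = (fderiv ℝ ψ x).inverse y := by
    refine christoffel_eq_of_metric_eq (isInvertible_of_posDef _ hpos') fun w => ?_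
    rw [hx, ContinuousLinearMap.bilinearComp_apply, hP.self_apply_inverse, koszul_apply,
      fderiv_pullback_apply (hG.differentiableAt (by norm_num)) hψ h hG',
      fderiv_pullback_apply (hG.differentiableAt (by norm_num)) hψ h hG',
      fderiv_pullback_apply (hG.differentiableAt (by norm_num)) hψ h hG', hy, map_add,
      add_apply, metric_christoffel hi, koszul_apply,
      hs.eq v u, hs.eq w u, hs.eq w v, hsymm (fderiv ℝ (fderiv ℝ ψ) x u w),
      hsymm (fderiv ℝ ψ x u) (fderiv ℝ (fderiv ℝ ψ) x v w)]
    ring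
  rw [key, hP.self_apply_inverse]

/-- Differentiate the transformation law of the Christoffel symbols and antisymmetrize in u and v:
the third derivative of ψ drops out by symmetry, and the remaining second-derivative terms are
absorbed by the quadratic part of the curvature. -/
theorem riemannCurv_pullback {G G' : E → (E →L[ℝ] E →L[ℝ] ℝ)} {ψ : E → E} {x : E}
    (hG : ContDiffAt ℝ 2 G (ψ x)) (hsymm : ∀ y u v, G y u v = G y v u)
    (hpos : ∀ y u, u ≠ 0 → 0 < G y u u) (hψ : ContDiffAt ℝ 3 ψ x)
    (hP : (fderiv ℝ ψ x).IsInvertible)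
    (h : ∀ᶠ y in 𝓝 x, G' y = (G (ψ y)).bilinearComp (fderiv ℝ ψ y) (fderiv ℝ ψ y)) (u v w : E) :
    fderiv ℝ ψ x (riemannCurv G' x v w u) =
      riemannCurv G (ψ x) (fderiv ℝ ψ x v) (fderiv ℝ ψ x w) (fderiv ℝ ψ x u) := by
  have hψ2 : ContDiffAt ℝ 2 ψ x := hψ.of_le (by norm_num)
  have hψ' : HasFDerivAt ψ (fderiv ℝ ψ x) x := (hψ.differentiableAt (by norm_num)).hasFDerivAt
  have hD' : ContDiffAt ℝ 2 (fderiv ℝ ψ) x := hψ.fderiv_right (by norm_num)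
  have hD : HasFDerivAt (fderiv ℝ ψ) (fderiv ℝ (fderiv ℝ ψ) x) x :=
    (hD'.differentiableAt (by norm_num)).hasFDerivAt
  have hDD : HasFDerivAt (fderiv ℝ (fderiv ℝ ψ)) (fderiv ℝ (fderiv ℝ (fderiv ℝ ψ)) x) x :=
    ((hD'.fderiv_right (m := 1) (by norm_num)).differentiableAt (by norm_num)).hasFDerivAt
  have hs : IsSymmSndFDerivAt ℝ ψ x := hψ2.isSymmSndFDerivAt (by simp)
  have hs' : IsSymmSndFDerivAt ℝ (fderiv ℝ ψ) x := hD'.isSymmSndFDerivAt (by simp)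
  have hpos' : ∀ u, u ≠ 0 → 0 < G' x u u := fun u hu => by
    rw [h.self_of_nhds]
    exact hpos _ _ fun h0 => hu (hP.injective (by simpa using h0))
  have hG' : ContDiffAt ℝ 2 G' x :=
    (ContDiffAt.bilinearComp (hG.comp x hψ2) hD').congr_of_eventuallyEq h
  have hΓ : HasFDerivAt (christoffel G) (fderiv ℝ (christoffel G) (ψ x)) (ψ x) :=
    ((hG.christoffel (m := 1) (by norm_num) (isInvertible_of_posDef _ (hpos _))).differentiableAt
      (by norm_num)).hasFDerivAt
  have hΓ' : HasFDerivAt (christoffel G') (fderiv ℝ (christoffel G') x) x :=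
    ((hG'.christoffel (m := 1) (by norm_num) (isInvertible_of_posDef _ hpos')).differentiableAt
      (by norm_num)).hasFDerivAt
  -- The law is needed on a neighbourhood, since it is differentiated next.
  have hev : ∀ᶠ y in 𝓝 x, ∀ u v, fderiv ℝ ψ y (christoffel G' y u v) =
      christoffel G (ψ y) (fderiv ℝ ψ y u) (fderiv ℝ ψ y v) + fderiv ℝ (fderiv ℝ ψ) y u v := by
    have e1 : ∀ᶠ y in 𝓝 x, ContDiffAt ℝ 2 G (ψ y) :=
      hψ'.continuousAt.eventually (hG.eventually (by norm_num))
    have e2 : ∀ᶠ y in 𝓝 x, (fderiv ℝ ψ y).IsInvertible := by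
      obtain ⟨e, he⟩ := hP
      have := ContinuousLinearEquiv.nhds e
      rw [he] at this
      exact (hD.continuousAt.eventually this).mono fun y ⟨e', he'⟩ => ⟨e', he'⟩
    filter_upwards [e1, e2, hψ.eventually (by norm_num), h.eventually_nhds] with y h1 h2 h3 h4
    exact christoffel_pullback (h1.of_le (by norm_num)) (hsymm _) (hpos _)
      (h3.of_le (by norm_num)) h2 h4
  have hx := hev.self_of_nhds
  have key : ∀ w u v : E, fderiv ℝ (fderiv ℝ ψ) x w (christoffel G' x u v)
      + fderiv ℝ ψ x (fderiv ℝ (christoffel G') x w u v) =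
      fderiv ℝ (christoffel G) (ψ x) (fderiv ℝ ψ x w) (fderiv ℝ ψ x u) (fderiv ℝ ψ x v)
      + christoffel G (ψ x) (fderiv ℝ (fderiv ℝ ψ) x w u) (fderiv ℝ ψ x v)
      + christoffel G (ψ x) (fderiv ℝ ψ x u) (fderiv ℝ (fderiv ℝ ψ) x w v)
      + fderiv ℝ (fderiv ℝ (fderiv ℝ ψ)) x w u v := by
    intro w u v
    have h1 := hD.clm_apply
      ((hΓ'.clm_apply (hasFDerivAt_const u x)).clm_apply (hasFDerivAt_const v x))
    have h2 := (((hΓ.comp x hψ').clm_apply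
      (hD.clm_apply (hasFDerivAt_const u x))).clm_apply (hD.clm_apply (hasFDerivAt_const v x))).add
      ((hDD.clm_apply (hasFDerivAt_const u x)).clm_apply (hasFDerivAt_const v x))
    have h3 := h2.congr_of_eventuallyEq
      (f₁ := fun y => fderiv ℝ ψ y (christoffel G' y u v)) (hev.mono fun y hy => by simp [hy])
    have h4 := congrArg (fun L => L w) (h1.unique h3)
    simp at h4
    rw [add_comm, h4]
    abel
  have k1 := key u v w
  have k2 := key v u w
  rw [hs'.eq v u, hs.eq v u] at k2
  simp only [riemannCurv_apply, map_add, map_sub, hx, eq_sub_of_add_eq' k1, eq_sub_of_add_eq' k2]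
  abel

theorem localRicci_pullback {G G' : E → (E →L[ℝ] E →L[ℝ] ℝ)} {ψ : E → E} {x : E}
    (hG : ContDiffAt ℝ 2 G (ψ x)) (hsymm : ∀ y u v, G y u v = G y v u)
    (hpos : ∀ y u, u ≠ 0 → 0 < G y u u) (hψ : ContDiffAt ℝ 3 ψ x)
    (hP : (fderiv ℝ ψ x).IsInvertible)
    (h : ∀ᶠ y in 𝓝 x, G' y = (G (ψ y)).bilinearComp (fderiv ℝ ψ y) (fderiv ℝ ψ y)) (v w : E) :
    localRicci G' x v w = localRicci G (ψ x) (fderiv ℝ ψ x v) (fderiv ℝ ψ x w) := by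
  obtain ⟨e, he⟩ := id hP
  unfold localRicci
  rw [← LinearMap.trace_conj' _ e.toLinearEquiv]
  congr 1
  refine LinearMap.ext fun u => ?_
  have h1 := riemannCurv_pullback hG hsymm hpos hψ hP h (e.symm u) v w
  have h2 : fderiv ℝ ψ x (e.symm u) = u := by rw [← he]; simp
  rw [h2] at h1
  rw [ContinuousLinearMap.coe_coe, ← h1, ← he]
  simp [LinearEquiv.conj_apply]

end LocalGeometry

/-! ### Hessian metrics on ℝⁿ and the curvature of their tube metrics. -/

noncomputable section HessianMetrics

open scoped Topology

variable {n : ℕ}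

/-! ### Determinants -/

/-- The determinant as a continuous multilinear map of the rows. -/
def detRows (n : ℕ) : ContinuousMultilinearMap ℝ (fun _ : Fin n => Fin n → ℝ) ℝ where
  toMultilinearMap := (Matrix.detRowAlternating (n := Fin n) (R := ℝ)).toMultilinearMap
  cont := (continuous_id (X := Matrix (Fin n) (Fin n) ℝ)).matrix_det

theorem contDiff_det {W : Type*} [NormedAddCommGroup W] [NormedSpace ℝ W] {k : ℕ∞ω}
    {m : W → Matrix (Fin n) (Fin n) ℝ} (hm : ∀ i j, ContDiff ℝ k fun x => m x i j) :
    ContDiff ℝ k fun x => (m x).det :=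
  (detRows n).contDiff.comp (contDiff_pi.2 fun i => contDiff_pi.2 fun j => hm i j)

/-- Jacobi's formula, with N in the role of the derivative times the inverse. By multilinearity in
the rows, replacing row i by row i of N times the matrix only retains the coefficient N i i. -/
theorem hasDerivAt_det {m : ℝ → Matrix (Fin n) (Fin n) ℝ} {m' N : Matrix (Fin n) (Fin n) ℝ} {t : ℝ}
    (hm : ∀ i j, HasDerivAt (fun s => m s i j) (m' i j) t) (hN : m' = N * m t) :
    HasDerivAt (fun s => (m s).det) (N.trace * (m t).det) t := by
  have h1 : ∀ i, HasFDerivAt (fun s => m s i)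
      (ContinuousLinearMap.toSpanSingleton ℝ (m' i)) t := fun i =>
    (hasDerivAt_pi.2 fun j => hm i j).hasFDerivAt
  have h2 := (HasFDerivAt.multilinear_comp (f := detRows n) h1).hasDerivAt
  convert! h2 using 1
  simp only [sum_apply, ContinuousLinearMap.comp_apply,
    ContinuousLinearMap.toSpanSingleton_apply, one_smul, Matrix.trace, Finset.sum_mul]
  refine Finset.sum_congr rfl fun i _ => ?_
  have h3 := Matrix.det_updateRow_sum (m t) i (N i)
  rw [smul_eq_mul] at h3
  rw [Matrix.diag_apply, ← h3]
  have h4 : ∑ k, N i k • m t k = m' i := by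
    rw [hN]
    ext j
    simp [Matrix.mul_apply]
  rw [h4]
  rfl

/-- The Gram matrix of the standard basis. -/
def gram (B : (Fin n → ℝ) →L[ℝ] (Fin n → ℝ) →L[ℝ] ℝ) : Matrix (Fin n) (Fin n) ℝ :=
  Matrix.of fun i j => B (Pi.single i 1) (Pi.single j 1)

theorem sum_smul_single (u : Fin n → ℝ) : ∑ i, u i • (Pi.single i 1 : Fin n → ℝ) = u := by
  ext j
  simp [Pi.single_apply]

theorem posDef_gram {B : (Fin n → ℝ) →L[ℝ] (Fin n → ℝ) →L[ℝ] ℝ} (hs : ∀ u v, B u v = B v u)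
    (hp : ∀ u, u ≠ 0 → 0 < B u u) : (gram B).PosDef := by
  refine Matrix.PosDef.of_dotProduct_mulVec_pos ?_ fun u hu => ?_
  · ext i j
    simp [gram, hs (Pi.single j 1)]
  · have h1 := hp u hu
    rw [← sum_smul_single u] at h1
    simp only [map_sum, map_smul, sum_apply, smul_apply, smul_eq_mul] at h1
    refine h1.trans_eq ?_
    simp only [dotProduct, Matrix.mulVec, gram, Matrix.of_apply, star_trivial]
    exact Finset.sum_congr rfl fun i _ =>
      congrArg _ (Finset.sum_congr rfl fun j _ => by rw [hs, mul_comm])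

/-- Puts derivatives of Gram matrices into the factored form required by `hasDerivAt_det`; the
images of the basis vectors are the rows of the left factor. -/
theorem gram_mul_apply (B : (Fin n → ℝ) →L[ℝ] (Fin n → ℝ) →L[ℝ] ℝ)
    (T : (Fin n → ℝ) → (Fin n → ℝ)) (i j : Fin n) :
    ((Matrix.of fun i k => T (Pi.single i 1) k) * gram B) i j
      = B (T (Pi.single i 1)) (Pi.single j 1) := by
  conv_rhs => rw [← sum_smul_single (T (Pi.single i 1))]
  simp [Matrix.mul_apply, gram]

/-- The trace of an endomorphism of `ℝⁿ` as a continuous linear functional. -/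
def traceCLM (n : ℕ) : ((Fin n → ℝ) →L[ℝ] (Fin n → ℝ)) →L[ℝ] ℝ :=
  ∑ i, (ContinuousLinearMap.proj (R := ℝ) (φ := fun _ : Fin n => ℝ) i) ∘L
    (ContinuousLinearMap.apply ℝ (Fin n → ℝ) (Pi.single i 1))

theorem traceCLM_apply (f : (Fin n → ℝ) →L[ℝ] (Fin n → ℝ)) :
    traceCLM n f = ∑ i, f (Pi.single i 1) i := by
  simp [traceCLM]

/-! ### Complexification of a Hessian metric -/

/-- Real parts of the coordinates. -/
def reL (n : ℕ) : Cn n →L[ℝ] (Fin n → ℝ) :=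
  ContinuousLinearMap.pi fun i => Complex.reCLM ∘L ContinuousLinearMap.proj i

/-- Imaginary parts of the coordinates. -/
def imL (n : ℕ) : Cn n →L[ℝ] (Fin n → ℝ) :=
  ContinuousLinearMap.pi fun i => Complex.imCLM ∘L ContinuousLinearMap.proj i

/-- The inclusion `ℝⁿ → ℂⁿ`. -/
def ofRealL (n : ℕ) : (Fin n → ℝ) →L[ℝ] Cn n :=
  ContinuousLinearMap.pi fun i => Complex.ofRealCLM ∘L ContinuousLinearMap.proj i

/-- The inclusion `ℝⁿ → iℝⁿ ⊆ ℂⁿ`. -/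
def ofImagL (n : ℕ) : (Fin n → ℝ) →L[ℝ] Cn n :=
  ContinuousLinearMap.pi fun i =>
    (ContinuousLinearMap.mul ℝ ℂ Complex.I ∘L Complex.ofRealCLM) ∘L ContinuousLinearMap.proj i

@[simp] theorem reL_apply (z : Cn n) (i : Fin n) : reL n z i = (z i).re := rfl
@[simp] theorem imL_apply (z : Cn n) (i : Fin n) : imL n z i = (z i).im := rfl
@[simp] theorem ofRealL_apply (x : Fin n → ℝ) (i : Fin n) : ofRealL n x i = (x i : ℂ) := rfl
@[simp] theorem ofImagL_apply (x : Fin n → ℝ) (i : Fin n) : ofImagL n x i = Complex.I * (x i : ℂ) :=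
  rfl

@[simp] theorem reL_ofRealL (x : Fin n → ℝ) : reL n (ofRealL n x) = x := by ext; simp
@[simp] theorem imL_ofRealL (x : Fin n → ℝ) : imL n (ofRealL n x) = 0 := by ext; simp
@[simp] theorem reL_ofImagL (x : Fin n → ℝ) : reL n (ofImagL n x) = 0 := by ext; simp
@[simp] theorem imL_ofImagL (x : Fin n → ℝ) : imL n (ofImagL n x) = x := by ext; simp

theorem ofRealL_add_ofImagL (z : Cn n) : ofRealL n (reL n z) + ofImagL n (imL n z) = z := by
  ext i
  simp [mul_comm Complex.I, Complex.re_add_im]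

theorem eq_zero_of_reL_imL {z : Cn n} (h1 : reL n z = 0) (h2 : imL n z = 0) : z = 0 := by
  rw [← ofRealL_add_ofImagL z, h1, h2, map_zero, map_zero, add_zero]

/-- In the real basis made of the standard vectors and their multiples by i, the trace is the sum of
those of the two diagonal blocks. -/
theorem trace_Cn (f : Cn n →L[ℝ] Cn n) :
    LinearMap.trace ℝ (Cn n) (f : Cn n →ₗ[ℝ] Cn n) =
      traceCLM n (reL n ∘L f ∘L ofRealL n) + traceCLM n (imL n ∘L f ∘L ofImagL n) := by
  have hs1 : ∀ i : Fin n, (Pi.single i (1 : ℂ) : Cn n) = ofRealL n (Pi.single i 1) := by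
    intro i
    ext j
    rcases eq_or_ne j i with rfl | h <;> simp [*]
  have hs2 : ∀ i : Fin n, (Pi.single i Complex.I : Cn n) = ofImagL n (Pi.single i 1) := by
    intro i
    ext j
    rcases eq_or_ne j i with rfl | h <;> simp [*]
  rw [LinearMap.trace_eq_matrix_trace ℝ (Pi.basis fun _ : Fin n => Complex.basisOneI), Matrix.trace,
    Fintype.sum_sigma]
  simp [LinearMap.toMatrix_apply, traceCLM_apply, Finset.sum_add_distrib, hs1, hs2]

/-- The Hermitian metric on the tube `ℝⁿ + iℝⁿ` induced by a metric on `ℝⁿ`. -/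
def tubeMetric (h : (Fin n → ℝ) → ((Fin n → ℝ) →L[ℝ] (Fin n → ℝ) →L[ℝ] ℝ)) (z : Cn n) :
    Cn n →L[ℝ] Cn n →L[ℝ] ℝ :=
  (h (reL n z)).bilinearComp (reL n) (reL n) + (h (reL n z)).bilinearComp (imL n) (imL n)

theorem tubeMetric_apply (h : (Fin n → ℝ) → ((Fin n → ℝ) →L[ℝ] (Fin n → ℝ) →L[ℝ] ℝ))
    (z u v : Cn n) : tubeMetric h z u v =
      h (reL n z) (reL n u) (reL n v) + h (reL n z) (imL n u) (imL n v) := rfl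

/-- A Hessian metric on `ℝⁿ`: a smooth metric with totally symmetric derivative. -/
structure IsHessianMetric (h : (Fin n → ℝ) → ((Fin n → ℝ) →L[ℝ] (Fin n → ℝ) →L[ℝ] ℝ)) :
    Prop where
  smooth : ContDiff ℝ ∞ h
  symm : ∀ x u v, h x u v = h x v u
  pos : ∀ x u, u ≠ 0 → 0 < h x u u
  deriv_symm : ∀ x u v w, fderiv ℝ h x u v w = fderiv ℝ h x v u w

/-- Half the logarithm of the determinant of a metric on `ℝⁿ`. -/
def logDensity (h : (Fin n → ℝ) → ((Fin n → ℝ) →L[ℝ] (Fin n → ℝ) →L[ℝ] ℝ)) (x : Fin n → ℝ) : ℝ :=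
  1 / 2 * Real.log (gram (h x)).det

namespace IsHessianMetric

variable {h : (Fin n → ℝ) → ((Fin n → ℝ) →L[ℝ] (Fin n → ℝ) →L[ℝ] ℝ)} (H : IsHessianMetric h)

include H

theorem hasFDerivAt (x : Fin n → ℝ) : HasFDerivAt h (fderiv ℝ h x) x :=
  (H.smooth.differentiable (by simp) x).hasFDerivAt

theorem isInvertible (x : Fin n → ℝ) : (h x).IsInvertible := isInvertible_of_posDef _ (H.pos x)

theorem fderiv_symm_right (x u v w : Fin n → ℝ) : fderiv ℝ h x u v w = fderiv ℝ h x u w v := by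
  have h1 : ∀ v w, HasFDerivAt (fun y => h y v w) _ x := fun v w =>
    ((H.hasFDerivAt x).clm_apply (hasFDerivAt_const v x)).clm_apply (hasFDerivAt_const w x)
  have h2 := h1 v w
  simp only [H.symm _ v w] at h2
  have h3 := congrArg (fun L => L u) (h2.unique (h1 w v))
  simpa using h3

/-- By total symmetry the three Koszul terms coincide up to sign, and two of them cancel. -/
theorem koszul_eq (x u v w : Fin n → ℝ) : koszul h x u v w = 1 / 2 * fderiv ℝ h x u v w := by
  rw [koszul_apply, H.deriv_symm x v u, H.deriv_symm x w u v, H.fderiv_symm_right x u w v]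
  ring

theorem metric_christoffel (x u v w : Fin n → ℝ) :
    h x (christoffel h x u v) w = 1 / 2 * fderiv ℝ h x u v w := by
  rw [_root_.metric_christoffel (H.isInvertible x), H.koszul_eq]

theorem eq_of_metric_eq {x u v : Fin n → ℝ} (huv : ∀ w, h x u w = h x v w) : u = v :=
  (H.isInvertible x).injective (ContinuousLinearMap.ext huv)

theorem christoffel_symm (x u v : Fin n → ℝ) : christoffel h x u v = christoffel h x v u :=
  H.eq_of_metric_eq fun w => by
    rw [H.metric_christoffel, H.metric_christoffel, H.deriv_symm]

theorem contDiff_christoffel : ContDiff ℝ ∞ (christoffel h) :=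
  contDiff_iff_contDiffAt.2 fun x =>
    H.smooth.contDiffAt.christoffel (by simp) (H.isInvertible x)

theorem hasFDerivAt_christoffel (x : Fin n → ℝ) :
    HasFDerivAt (christoffel h) (fderiv ℝ (christoffel h) x) x :=
  (H.contDiff_christoffel.differentiable (by simp) x).hasFDerivAt

theorem fderiv_christoffel_symm (x u v w : Fin n → ℝ) :
    fderiv ℝ (christoffel h) x u v w = fderiv ℝ (christoffel h) x u w v := by
  have h1 : ∀ v w, HasFDerivAt (fun y => christoffel h y v w) _ x := fun v w =>
    ((H.hasFDerivAt_christoffel x).clm_apply (hasFDerivAt_const v x)).clm_apply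
      (hasFDerivAt_const w x)
  have h2 := h1 v w
  simp only [H.christoffel_symm _ v w] at h2
  have h3 := congrArg (fun L => L u) (h2.unique (h1 w v))
  simpa using h3

/-- Differentiate h(Γ(v, w), y) = ½ (∂_v h)(w, y) along u. The right side becomes symmetric in u and
v, and on the left the derivative of h is again 2h(Γ(u, ·), ·), which accounts for the quadratic
terms. -/
theorem fderiv_christoffel_swap (x u v w : Fin n → ℝ) :
    fderiv ℝ (christoffel h) x u v w = fderiv ℝ (christoffel h) x v u w
      + (2 : ℝ) • christoffel h x v (christoffel h x u w)
      - (2 : ℝ) • christoffel h x u (christoffel h x v w) := by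
  have hDD : HasFDerivAt (fderiv ℝ h) (fderiv ℝ (fderiv ℝ h) x) x :=
    (((H.smooth.fderiv_right (m := ∞) (by simp)).differentiable (by simp)) x).hasFDerivAt
  have hs : IsSymmSndFDerivAt ℝ h x := H.smooth.contDiffAt.isSymmSndFDerivAt (by
    rw [minSmoothness_of_isRCLikeNormedField]
    exact WithTop.coe_le_coe.2 (le_top (a := (2 : ℕ∞))))
  have key : ∀ u v w y, fderiv ℝ h x u (christoffel h x v w) y
      + h x (fderiv ℝ (christoffel h) x u v w) y = 1 / 2 * fderiv ℝ (fderiv ℝ h) x u v w y := by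
    intro u v w y
    have h1 := ((H.hasFDerivAt x).clm_apply (((H.hasFDerivAt_christoffel x).clm_apply
      (hasFDerivAt_const v x)).clm_apply (hasFDerivAt_const w x))).clm_apply (hasFDerivAt_const y x)
    have h2 := (((hDD.clm_apply (hasFDerivAt_const v x)).clm_apply
      (hasFDerivAt_const w x)).clm_apply (hasFDerivAt_const y x)).const_mul (1 / 2)
    simp only [H.metric_christoffel] at h1
    have h3 := congrArg (fun L => L u) (h1.unique h2)
    simp at h3
    linarith
  refine H.eq_of_metric_eq (x := x) fun y => ?_
  have k1 := key u v w y
  have k2 := key v u w y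
  rw [hs.eq v u] at k2
  simp only [map_add, map_sub, map_smul, add_apply, sub_apply, smul_apply, smul_eq_mul,
    H.metric_christoffel]
  linarith

/-- Jacobi's formula applied to ∂_b h = h(2Γ(b, ·), ·); the factor 2 cancels the ½ in the
definition. -/
theorem hasDerivAt_logDensity (x b : Fin n → ℝ) :
    HasDerivAt (fun t : ℝ => logDensity h (x + t • b)) (traceCLM n (christoffel h x b)) 0 := by
  have hp : 0 < (gram (h x)).det := (posDef_gram (H.symm x) (H.pos x)).det_pos
  have hl : HasDerivAt (fun t : ℝ => x + t • b) b 0 := by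
    simpa using ((hasDerivAt_id (0 : ℝ)).smul_const b).const_add x
  have h0 : x + (0 : ℝ) • b = x := by simp
  have h1 : HasDerivAt (fun t : ℝ => (gram (h (x + t • b))).det)
      ((Matrix.of fun i k => ((2 : ℝ) • christoffel h x b) (Pi.single i 1) k).trace
        * (gram (h (x + (0 : ℝ) • b))).det) 0 := by
    refine hasDerivAt_det (m' := Matrix.of fun i j =>
      fderiv ℝ h x b (Pi.single i 1) (Pi.single j 1)) (fun i j => ?_) ?_
    · have h2 : HasFDerivAt (fun y => h y (Pi.single i 1) (Pi.single j 1)) _ (x + (0 : ℝ) • b) :=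
        ((H.hasFDerivAt _).clm_apply (hasFDerivAt_const _ _)).clm_apply (hasFDerivAt_const _ _)
      refine (h2.comp_hasDerivAt (0 : ℝ) hl).congr_deriv ?_
      rw [h0]
      simp
    · rw [h0]
      ext i j
      rw [gram_mul_apply]
      simp [H.metric_christoffel]
  have h2 := (h1.log (by rw [h0]; exact hp.ne')).const_mul (1 / 2)
  refine h2.congr_deriv ?_
  rw [h0, mul_div_cancel_right₀ _ hp.ne']
  simp [Matrix.trace, traceCLM_apply, Finset.mul_sum]

theorem contDiff_logDensity : ContDiff ℝ ∞ (logDensity h) := by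
  refine contDiff_const.mul (ContDiff.log (contDiff_det fun i j => ?_) fun x =>
    (posDef_gram (H.symm x) (H.pos x)).det_pos.ne')
  exact (H.smooth.clm_apply contDiff_const).clm_apply contDiff_const

theorem fderiv_logDensity (x b : Fin n → ℝ) :
    fderiv ℝ (logDensity h) x b = traceCLM n (christoffel h x b) := by
  have hl : HasDerivAt (fun t : ℝ => x + t • b) b 0 := by
    simpa using ((hasDerivAt_id (0 : ℝ)).smul_const b).const_add x
  have h0 : x + (0 : ℝ) • b = x := by simp
  have h1 : HasFDerivAt (logDensity h) (fderiv ℝ (logDensity h) x) (x + (0 : ℝ) • b) := by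
    rw [h0]
    exact (H.contDiff_logDensity.differentiable (by simp) x).hasFDerivAt
  have h2 := HasFDerivAt.comp_hasDerivAt (0 : ℝ) h1 hl
  exact h2.unique (H.hasDerivAt_logDensity x b)

theorem fderiv_fderiv_logDensity (x a b : Fin n → ℝ) :
    fderiv ℝ (fderiv ℝ (logDensity h)) x a b = traceCLM n (fderiv ℝ (christoffel h) x a b) := by
  have h1 : HasFDerivAt (fderiv ℝ (logDensity h)) (fderiv ℝ (fderiv ℝ (logDensity h)) x) x :=
    (((H.contDiff_logDensity.fderiv_right (m := ∞) (by simp)).differentiable (by simp)) x).hasFDerivAt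
  have h2 := h1.clm_apply (hasFDerivAt_const b x)
  simp only [H.fderiv_logDensity] at h2
  have h3 := (traceCLM n).hasFDerivAt.comp x
    ((H.hasFDerivAt_christoffel x).clm_apply (hasFDerivAt_const b x))
  have h4 := congrArg (fun L => L a) (h2.unique h3)
  simpa using h4

theorem contDiff_tubeMetric : ContDiff ℝ ∞ (tubeMetric h) := by
  have h1 : ContDiff ℝ ∞ fun z => h (reL n z) := H.smooth.comp (reL n).contDiff
  refine contDiff_iff_contDiffAt.2 fun z => ?_
  exact (ContDiffAt.bilinearComp h1.contDiffAt contDiffAt_const).add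
    (ContDiffAt.bilinearComp h1.contDiffAt contDiffAt_const)

theorem tubeMetric_symm (z u v : Cn n) : tubeMetric h z u v = tubeMetric h z v u := by
  simp only [tubeMetric_apply, H.symm _ (reL n u), H.symm _ (imL n u)]

theorem nonneg (x u : Fin n → ℝ) : 0 ≤ h x u u := by
  rcases eq_or_ne u 0 with rfl | hu
  · simp
  · exact (H.pos x u hu).le

theorem tubeMetric_pos (z u : Cn n) (hu : u ≠ 0) : 0 < tubeMetric h z u u := by
  rw [tubeMetric_apply]
  by_cases h1 : reL n u = 0
  · have h2 : imL n u ≠ 0 := fun h2 => hu (eq_zero_of_reL_imL h1 h2)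
    exact add_pos_of_nonneg_of_pos (H.nonneg _ _) (H.pos _ _ h2)
  · exact add_pos_of_pos_of_nonneg (H.pos _ _ h1) (H.nonneg _ _)

theorem fderiv_tubeMetric (z u v w : Cn n) : fderiv ℝ (tubeMetric h) z u v w =
    fderiv ℝ h (reL n z) (reL n u) (reL n v) (reL n w)
      + fderiv ℝ h (reL n z) (reL n u) (imL n v) (imL n w) := by
  have h1 := (((H.contDiff_tubeMetric.differentiable (by simp) z).hasFDerivAt).clm_apply
    (hasFDerivAt_const v z)).clm_apply (hasFDerivAt_const w z)
  have h2 := (H.hasFDerivAt (reL n z)).comp z (reL n).hasFDerivAt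
  have h3 := ((h2.clm_apply (hasFDerivAt_const (reL n v) z)).clm_apply
    (hasFDerivAt_const (reL n w) z)).add ((h2.clm_apply (hasFDerivAt_const (imL n v) z)).clm_apply
    (hasFDerivAt_const (imL n w) z))
  have h4 := congrArg (fun L => L u) (h1.unique h3)
  simpa using h4

/-- This is the complex bilinear extension of the Christoffel symbol of h, reflecting that the tube
metric is Kähler. -/
theorem christoffel_tubeMetric (z u v : Cn n) : christoffel (tubeMetric h) z u v =
    ofRealL n (christoffel h (reL n z) (reL n u) (reL n v)
      - christoffel h (reL n z) (imL n u) (imL n v))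
    + ofImagL n (christoffel h (reL n z) (reL n u) (imL n v)
      + christoffel h (reL n z) (imL n u) (reL n v)) := by
  refine christoffel_eq_of_metric_eq (isInvertible_of_posDef _ (H.tubeMetric_pos z)) fun w => ?_
  simp only [koszul_apply, H.fderiv_tubeMetric, tubeMetric_apply, map_add, map_sub, reL_ofRealL,
    reL_ofImagL, imL_ofRealL, imL_ofImagL, add_zero, zero_add, sub_apply, add_apply, map_zero,
    zero_apply, H.metric_christoffel]
  set x := reL n z
  rw [H.deriv_symm x (reL n v) (reL n u) (reL n w), H.deriv_symm x (reL n v) (imL n u) (imL n w),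
    H.deriv_symm x (reL n w) (reL n u) (reL n v), H.fderiv_symm_right x (reL n u) (reL n w),
    H.deriv_symm x (reL n w) (imL n u) (imL n v), H.fderiv_symm_right x (imL n u) (reL n w)]
  ring

theorem fderiv_christoffel_tubeMetric (z a u v : Cn n) :
    fderiv ℝ (christoffel (tubeMetric h)) z a u v =
    ofRealL n (fderiv ℝ (christoffel h) (reL n z) (reL n a) (reL n u) (reL n v)
      - fderiv ℝ (christoffel h) (reL n z) (reL n a) (imL n u) (imL n v))
    + ofImagL n (fderiv ℝ (christoffel h) (reL n z) (reL n a) (reL n u) (imL n v)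
      + fderiv ℝ (christoffel h) (reL n z) (reL n a) (imL n u) (reL n v)) := by
  have hd : DifferentiableAt ℝ (christoffel (tubeMetric h)) z :=
    ((H.contDiff_tubeMetric.contDiffAt (x := z)).christoffel (m := ∞) (by simp)
      (isInvertible_of_posDef _ (H.tubeMetric_pos z))).differentiableAt (by simp)
  have h1 := (hd.hasFDerivAt.clm_apply (hasFDerivAt_const u z)).clm_apply (hasFDerivAt_const v z)
  simp only [H.christoffel_tubeMetric] at h1
  have h2 := (H.hasFDerivAt_christoffel (reL n z)).comp z (reL n).hasFDerivAt
  have h3 : ∀ p q, HasFDerivAt (fun y => christoffel h (reL n y) p q) _ z := fun p q =>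
    (h2.clm_apply (hasFDerivAt_const p z)).clm_apply (hasFDerivAt_const q z)
  have h4 := ((ofRealL n).hasFDerivAt.comp z ((h3 (reL n u) (reL n v)).sub
    (h3 (imL n u) (imL n v)))).add ((ofImagL n).hasFDerivAt.comp z
    ((h3 (reL n u) (imL n v)).add (h3 (imL n u) (reL n v))))
  have h5 := congrArg (fun L => L a) (h1.unique h4)
  simpa using h5

/-- The identity already holds for endomorphisms of ℝⁿ before the trace is taken: in the sum of the
two diagonal blocks of the curvature, `fderiv_christoffel_swap` cancels all quadratic terms. -/
theorem localRicci_tubeMetric (z v : Cn n) : localRicci (tubeMetric h) z v v =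
    -(fderiv ℝ (fderiv ℝ (logDensity h)) (reL n z) (reL n v) (reL n v)
      + fderiv ℝ (fderiv ℝ (logDensity h)) (reL n z) (imL n v) (imL n v)) := by
  rw [localRicci, trace_Cn, ← map_add, H.fderiv_fderiv_logDensity, H.fderiv_fderiv_logDensity,
    ← map_add, ← map_neg]
  congr 1
  refine ContinuousLinearMap.ext fun a => ?_
  set x := reL n z with hx
  set p := reL n v with hp
  set q := imL n v with hq
  simp only [add_apply, neg_apply, ContinuousLinearMap.comp_apply, riemannCurv_apply,
    H.fderiv_christoffel_tubeMetric, H.christoffel_tubeMetric, map_add, map_sub, reL_ofRealL,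
    reL_ofImagL, imL_ofRealL, imL_ofImagL, map_zero, zero_apply, add_zero, zero_add, sub_zero,
    ← hx, ← hp, ← hq]
  rw [H.fderiv_christoffel_swap x a p p, H.fderiv_christoffel_swap x a q q,
    H.fderiv_christoffel_symm x p a p, H.fderiv_christoffel_symm x q a q,
    H.christoffel_symm x a p, H.christoffel_symm x a q]
  module

end IsHessianMetric

end HessianMetrics

/-! ### Orbits of the complex torus and the coordinates they carry. -/

noncomputable section ToricGeometry

open scoped Topology

/-! ### The exponential parametrization of an orbit -/

section Exp

variable {n : ℕ}

theorem torusExp_add (z w : Cn n) : torusExp (z + w) = torusExp z * torusExp w := by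
  ext i
  simp [torusExp, Complex.exp_add]

theorem torusExp_zero : torusExp (0 : Cn n) = 1 := by
  ext i
  simp [torusExp]

theorem torusExp_surjective : Function.Surjective (torusExp (n := n)) := fun a =>
  ⟨fun i => Complex.log (a i), by
    ext i
    simp [torusExp, Complex.exp_log]⟩

theorem expReal_eq (x : Fin n → ℝ) : expReal x = torusExp (ofRealL n x) := rfl

theorem expImag_eq (y : Fin n → ℝ) : expImag y = torusExp (ofImagL n y) := by
  unfold expImag
  congr 1
  ext i
  simp [mul_comm]

theorem eq_zero_of_torusExp_smul_eq_one {u : Cn n} (h : ∀ t : ℝ, torusExp (t • u) = 1) : u = 0 := by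
  ext i
  have h1 : HasDerivAt (fun t : ℝ => Complex.exp ((t : ℂ) * u i)) (u i) 0 := by
    have h2 := ((Complex.ofRealCLM.hasDerivAt (x := (0 : ℝ))).mul_const (u i)).cexp
    simpa using h2
  have h3 : (fun t : ℝ => Complex.exp ((t : ℂ) * u i)) = fun _ => 1 := by
    funext t
    have h4 := congrArg Units.val (congrFun (h t) i)
    simpa [torusExp] using h4
  rw [h3] at h1
  exact h1.unique (hasDerivAt_const _ _)

end Exp

variable {n : ℕ} {M : Type*} [TopologicalSpace M] [ChartedSpace (Cn n) M]

/-- A curve with vanishing velocity is constant. -/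
theorem eq_of_mfderiv_eq_zero [IsManifold 𝓘(ℝ, Cn n) ∞ M] {γ : ℝ → M}
    (hγ : MDifferentiable 𝓘(ℝ, ℝ) 𝓘(ℝ, Cn n) γ) (h0 : ∀ t, diffAt (n := n) γ t = 0) (s t : ℝ) :
    γ s = γ t := by
  refine IsLocallyConstant.apply_eq_of_preconnectedSpace
    ((IsLocallyConstant.iff_eventually_eq γ).2 fun t₀ => ?_) s t
  set e := extChartAt 𝓘(ℝ, Cn n) (γ t₀) with he
  have hU : γ ⁻¹' e.source ∈ 𝓝 t₀ :=
    (hγ t₀).continuousAt (extChartAt_source_mem_nhds (I := 𝓘(ℝ, Cn n)) (γ t₀))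
  obtain ⟨ε, hε, hb⟩ := Metric.mem_nhds_iff.1 hU
  have hd : ∀ t ∈ Metric.ball t₀ ε, HasFDerivAt (e ∘ γ) (0 : ℝ →L[ℝ] Cn n) t := fun t ht => by
    have h1 : MDifferentiableAt 𝓘(ℝ, Cn n) 𝓘(ℝ, Cn n) e (γ t) :=
      mdifferentiableAt_extChartAt (by simpa [he] using hb ht)
    have h2 := h1.hasMFDerivAt.comp t (hγ t).hasMFDerivAt
    have h3 := hasMFDerivAt_iff_hasFDerivAt.1 h2
    have h4 : mfderiv 𝓘(ℝ, ℝ) 𝓘(ℝ, Cn n) γ t = 0 := h0 t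
    rw [h4] at h3
    exact h3.congr_fderiv (ContinuousLinearMap.comp_zero _)
  filter_upwards [Metric.ball_mem_nhds t₀ hε] with t ht
  have h5 := Metric.isOpen_ball.is_const_of_fderiv_eq_zero (convex_ball t₀ ε).isPreconnected
    (fun t ht => (hd t ht).differentiableAt.differentiableWithinAt)
    (fun t ht => (hd t ht).fderiv) ht (Metric.mem_ball_self hε)
  exact e.injOn (hb ht) (hb (Metric.mem_ball_self hε)) h5

theorem diffAt_comp {W W' : Type*} [NormedAddCommGroup W] [NormedSpace ℝ W]
    [NormedAddCommGroup W'] [NormedSpace ℝ W'] {F : W → M} {Z : W' → W} {x : W'}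
    (hF : MDifferentiableAt 𝓘(ℝ, W) 𝓘(ℝ, Cn n) F (Z x)) (hZ : DifferentiableAt ℝ Z x) :
    diffAt (n := n) (fun y => F (Z y)) x = diffAt (n := n) F (Z x) ∘L fderiv ℝ Z x :=
  (hF.hasMFDerivAt.comp x hZ.hasFDerivAt.hasMFDerivAt).mfderiv

theorem diffAt_congr {W : Type*} [NormedAddCommGroup W] [NormedSpace ℝ W] {F F' : W → M} {x : W}
    (h : F =ᶠ[𝓝 x] F') : diffAt (n := n) F x = diffAt (n := n) F' x :=
  h.mfderiv_eq

theorem hasFDerivAt_extChartAt_comp {W : Type*} [NormedAddCommGroup W] [NormedSpace ℝ W]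
    {F : W → M} {x : W} (hF : MDifferentiableAt 𝓘(ℝ, W) 𝓘(ℝ, Cn n) F x) :
    HasFDerivAt (fun y => extChartAt 𝓘(ℝ, Cn n) (F x) (F y)) (diffAt (n := n) F x) x := by
  have h1 := hF.hasMFDerivAt.2
  simp only [writtenInExtChartAt, extChartAt_model_space_eq_id, PartialEquiv.refl_symm,
    PartialEquiv.refl_coe, modelWithCornersSelf_coe, Set.range_id, id_eq] at h1
  exact hasFDerivWithinAt_univ.1 h1

theorem pullbackMetric_apply [IsManifold 𝓘(ℂ, Cn n) ω M] {W : Type*} [NormedAddCommGroup W]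
    [NormedSpace ℝ W] (g : RiemMetric n M) (F : W → M) (x u v : W) :
    pullbackMetric g F x u v = metricAt g (F x) (diffAt (n := n) F x u) (diffAt (n := n) F x v) := rfl

theorem pullbackMetric_comp [IsManifold 𝓘(ℂ, Cn n) ω M] {W W' : Type*} [NormedAddCommGroup W]
    [NormedSpace ℝ W] [NormedAddCommGroup W'] [NormedSpace ℝ W'] (g : RiemMetric n M)
    {F : W → M} {F' : W' → M} {Z : W' → W} {x : W'} (h : F' =ᶠ[𝓝 x] fun y => F (Z y))
    (hF : MDifferentiableAt 𝓘(ℝ, W) 𝓘(ℝ, Cn n) F (Z x)) (hZ : DifferentiableAt ℝ Z x) :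
    pullbackMetric g F' x =
      (pullbackMetric g F (Z x)).bilinearComp (fderiv ℝ Z x) (fderiv ℝ Z x) := by
  ext u v
  rw [ContinuousLinearMap.bilinearComp_apply, pullbackMetric_apply, pullbackMetric_apply,
    diffAt_congr h, diffAt_comp hF hZ, h.self_of_nhds]
  rfl

theorem pullbackMetric_symm [IsManifold 𝓘(ℂ, Cn n) ω M] {W : Type*} [NormedAddCommGroup W]
    [NormedSpace ℝ W] (g : RiemMetric n M) (F : W → M) (x u v : W) :
    pullbackMetric g F x u v = pullbackMetric g F x v u :=
  g.symm (F x) (diffAt (n := n) F x u) (diffAt (n := n) F x v)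

theorem pullbackMetric_pos [IsManifold 𝓘(ℂ, Cn n) ω M] {W : Type*} [NormedAddCommGroup W]
    [NormedSpace ℝ W] (g : RiemMetric n M) (F : W → M) (x u : W) (hu : diffAt (n := n) F x u ≠ 0) :
    0 < pullbackMetric g F x u u :=
  g.pos (F x) (diffAt (n := n) F x u) hu

variable [MulAction (ComplexTorus n) M]

/-- The parametrization `z ↦ exp(z) p` of the orbit of `p`. -/
def expOrbit (p : M) (z : Cn n) : M := torusExp z • p

theorem expOrbit_add (p : M) (z w : Cn n) : expOrbit p (z + w) = expOrbit (expOrbit p z) w := by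
  rw [expOrbit, expOrbit, expOrbit, add_comm, torusExp_add, mul_smul]

@[simp] theorem expOrbit_zero (p : M) : expOrbit p (0 : Cn n) = p := by
  rw [expOrbit, torusExp_zero, one_smul]

theorem orbit_eq_range_expOrbit (p : M) :
    MulAction.orbit (ComplexTorus n) p = Set.range (expOrbit (n := n) p) := by
  ext q
  constructor
  · rintro ⟨a, rfl⟩
    obtain ⟨z, rfl⟩ := torusExp_surjective a
    exact ⟨z, rfl⟩
  · rintro ⟨z, rfl⟩
    exact ⟨torusExp z, rfl⟩

theorem expOrbit_mem_orbit (p : M) (z : Cn n) :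
    expOrbit p z ∈ MulAction.orbit (ComplexTorus n) p := ⟨torusExp z, rfl⟩

theorem orbitMap_eq (p : M) (y : Fin n → ℝ) : orbitMap p y = expOrbit p (ofImagL n y) := by
  rw [orbitMap, expImag_eq, expOrbit]

theorem expImag_smul_expOrbit (p : M) (y : Fin n → ℝ) (z : Cn n) :
    expImag y • expOrbit p z = expOrbit p (z + ofImagL n y) := by
  rw [expImag_eq, expOrbit_add]
  rfl

variable [IsManifold 𝓘(ℂ, Cn n) ω M]

namespace IsToric

variable (hM : IsToric n M)

include hM

theorem contMDiff_action : ContMDiff (𝓘(ℝ, Cn n).prod 𝓘(ℝ, Cn n)) 𝓘(ℝ, Cn n) ∞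
    (fun q : Cn n × M => expOrbit q.2 q.1) := fun q => by
  have h1 := contMDiffAt_iff.1 (hM.holomorphic q)
  refine contMDiffAt_iff.2 ⟨h1.1, ?_⟩
  exact (ContDiffWithinAt.restrict_scalars ℝ h1.2).of_le le_top

theorem contMDiff_expOrbit (p : M) : ContMDiff 𝓘(ℝ, Cn n) 𝓘(ℝ, Cn n) ∞ (expOrbit (n := n) p) :=
  hM.contMDiff_action.comp (contMDiff_id.prodMk contMDiff_const)

theorem mdifferentiable_expOrbit (p : M) :
    MDifferentiable 𝓘(ℝ, Cn n) 𝓘(ℝ, Cn n) (expOrbit (n := n) p) :=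
  (hM.contMDiff_expOrbit p).mdifferentiable (by simp)

theorem contMDiff_smul (w : Cn n) :
    ContMDiff 𝓘(ℝ, Cn n) 𝓘(ℝ, Cn n) ∞ (fun q : M => expOrbit q w) :=
  hM.contMDiff_action.comp (contMDiff_const.prodMk contMDiff_id)

theorem diffAt_expOrbit_I (p : M) (z u : Cn n) :
    diffAt (n := n) (expOrbit (n := n) p) z (Complex.I • u) = Complex.I • diffAt (n := n) (expOrbit (n := n) p) z u := by
  have h1 : ContMDiff 𝓘(ℂ, Cn n) 𝓘(ℂ, Cn n) ω (expOrbit (n := n) p) :=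
    hM.holomorphic.comp (contMDiff_id.prodMk contMDiff_const)
  have h2 := ((h1 z).mdifferentiableAt (by simp)).hasMFDerivAt
  have h3 : HasMFDerivAt 𝓘(ℝ, Cn n) 𝓘(ℝ, Cn n) (expOrbit (n := n) p) z
      ((mfderiv 𝓘(ℂ, Cn n) 𝓘(ℂ, Cn n) (expOrbit (n := n) p) z : Cn n →L[ℂ] Cn n).restrictScalars ℝ) :=
    ⟨h2.1, h2.2.restrictScalars ℝ⟩
  have h4 : diffAt (n := n) (expOrbit (n := n) p) z =
      (mfderiv 𝓘(ℂ, Cn n) 𝓘(ℂ, Cn n) (expOrbit (n := n) p) z : Cn n →L[ℂ] Cn n).restrictScalars ℝ :=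
    h3.mfderiv
  rw [h4]
  exact map_smul (mfderiv 𝓘(ℂ, Cn n) 𝓘(ℂ, Cn n) (expOrbit (n := n) p) z : Cn n →L[ℂ] Cn n) Complex.I u

/-- The group is abelian, so translation by w intertwines the parametrization at z and at z + w: the
kernel of the differential is the same all along the orbit. -/
theorem diffAt_expOrbit_eq_zero {p : M} {z w u : Cn n} (h : diffAt (n := n) (expOrbit (n := n) p) z u = 0) :
    diffAt (n := n) (expOrbit (n := n) p) (z + w) u = 0 := by
  have h1 : HasMFDerivAt 𝓘(ℝ, Cn n) 𝓘(ℝ, Cn n) (fun y => expOrbit (expOrbit p y) w) z _ :=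
    (((hM.contMDiff_smul w).mdifferentiable (by simp)) (expOrbit p z)).hasMFDerivAt.comp z
      (hM.mdifferentiable_expOrbit p z).hasMFDerivAt
  have h2 := diffAt_comp (F := expOrbit (n := n) p) (Z := fun y => y + w) (x := z)
    (hM.mdifferentiable_expOrbit p _) (by fun_prop)
  simp only [expOrbit_add] at h2
  rw [fderiv_add_const, fderiv_fun_id, ContinuousLinearMap.comp_id] at h2
  rw [← h2]
  have h3 : diffAt (n := n) (fun y => expOrbit (expOrbit p y) w) z u =
      mfderiv 𝓘(ℝ, Cn n) 𝓘(ℝ, Cn n) (fun q : M => expOrbit q w) (expOrbit p z)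
        (diffAt (n := n) (expOrbit (n := n) p) z u) :=
    congrArg (fun L : Cn n →L[ℝ] Cn n => L u) h1.mfderiv
  rw [h3, h]
  exact map_zero (mfderiv 𝓘(ℝ, Cn n) 𝓘(ℝ, Cn n) (fun q : M => expOrbit q w) (expOrbit p z))

/-- The given dense orbit meets every nonempty open set, hence equals any open orbit. -/
theorem dense_orbit {p : M} (hp : IsOpen (MulAction.orbit (ComplexTorus n) p)) :
    Dense (MulAction.orbit (ComplexTorus n) p) := by
  obtain ⟨q, -, hq⟩ := hM.exists_dense_open_orbit
  obtain ⟨r, hr1, hr2⟩ := hq.inter_open_nonempty _ hp ⟨p, MulAction.mem_orbit_self p⟩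
  rw [← MulAction.orbit_eq_iff.2 hr1, MulAction.orbit_eq_iff.2 hr2]
  exact hq

/-- In an abelian group an element fixing p fixes its whole orbit, by density and the Hausdorff
property all of M, and so is trivial by effectiveness. -/
theorem eq_one_of_smul_eq [T2Space M] {p : M}
    (hp : IsOpen (MulAction.orbit (ComplexTorus n) p)) {a : ComplexTorus n} (ha : a • p = p) :
    a = 1 := by
  have := hM.effective
  obtain ⟨w, rfl⟩ := torusExp_surjective a
  have hc : IsClosed {q : M | torusExp w • q = q} :=
    isClosed_eq (hM.contMDiff_smul w).continuous continuous_id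
  have hs : MulAction.orbit (ComplexTorus n) p ⊆ {q : M | torusExp w • q = q} := by
    rintro _ ⟨b, rfl⟩
    change torusExp w • b • p = b • p
    rw [smul_comm, ha]
  have hu : ∀ q : M, torusExp w • q = q := fun q =>
    hc.closure_subset_iff.2 hs (hM.dense_orbit hp q)
  exact FaithfulSMul.eq_of_smul_eq_smul fun q => by rw [hu q, one_smul]

/-- A kernel vector u makes the curve t ↦ exp(tu) p stationary, so exp(tu) fixes p for all t; the
stabilizer being trivial, u vanishes. -/
theorem diffAt_expOrbit_injective [T2Space M] {p : M}
    (hp : IsOpen (MulAction.orbit (ComplexTorus n) p)) {z u : Cn n}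
    (hu : diffAt (n := n) (expOrbit (n := n) p) z u = 0) : u = 0 := by
  refine eq_zero_of_torusExp_smul_eq_one fun t => hM.eq_one_of_smul_eq hp ?_
  have hd : ∀ s : ℝ, HasDerivAt (fun s : ℝ => s • u) u s := fun s => by
    simpa using (hasDerivAt_id s).smul_const u
  have h1 : ∀ s : ℝ, diffAt (n := n) (fun s : ℝ => expOrbit p (s • u)) s = 0 := fun s => by
    rw [diffAt_comp (hM.mdifferentiable_expOrbit p _) (hd s).differentiableAt]
    ext1
    rw [ContinuousLinearMap.comp_apply, (hd s).hasFDerivAt.fderiv]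
    have h2 := hM.diffAt_expOrbit_eq_zero (w := s • u - z) hu
    rw [add_sub_cancel] at h2
    simpa using h2
  have h3 : MDifferentiable 𝓘(ℝ, ℝ) 𝓘(ℝ, Cn n) (fun s : ℝ => expOrbit p (s • u)) :=
    (hM.mdifferentiable_expOrbit p).comp
      fun s => (hd s).differentiableAt.mdifferentiableAt
  have h4 := eq_of_mfderiv_eq_zero h3 h1 t 0
  rw [zero_smul, expOrbit_zero] at h4
  exact h4

/-- Where its differential is injective, the parametrization of an orbit has a local inverse. -/
theorem exists_local_inverse {p : M} {z : Cn n}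
    (hz : ∀ u, diffAt (n := n) (expOrbit (n := n) p) z u = 0 → u = 0) :
    ∃ L : M → Cn n, L (expOrbit p z) = z ∧
      ContMDiffAt 𝓘(ℝ, Cn n) 𝓘(ℝ, Cn n) 3 L (expOrbit p z) ∧
      (∀ᶠ q in 𝓝 (expOrbit p z), expOrbit p (L q) = q) := by
  obtain ⟨e', he'⟩ := (diffAt (n := n) (expOrbit (n := n) p) z).isInvertible_of_injective rfl hz
  set e := extChartAt 𝓘(ℝ, Cn n) (expOrbit p z) with he
  set f : Cn n → Cn n := fun w => e (expOrbit p w) with hf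
  have hs : ContDiffAt ℝ 3 f z := by
    rw [← contMDiffAt_iff_contDiffAt]
    exact ((contMDiffAt_extChartAt (n := ∞)).comp z (hM.contMDiff_expOrbit p z)).of_le
      (WithTop.coe_le_coe.2 (le_top (a := (3 : ℕ∞))))
  have hf' : HasFDerivAt f (e' : Cn n →L[ℝ] Cn n) z := by
    rw [he']
    exact hasFDerivAt_extChartAt_comp (hM.mdifferentiable_expOrbit p z)
  have hn : (3 : ℕ∞ω) ≠ 0 := by norm_num
  set L₀ := hs.localInverse hf' hn with hL₀
  have h1 : L₀ (f z) = z := hs.localInverse_apply_image hf' hn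
  refine ⟨fun q => L₀ (e q), h1, ?_, ?_⟩
  · exact (hs.to_localInverse hf' hn).contMDiffAt.comp (expOrbit p z)
      ((contMDiffAt_extChartAt (n := ∞)).of_le
      (WithTop.coe_le_coe.2 (le_top (a := (3 : ℕ∞)))))
  · have h2 : ∀ᶠ y in 𝓝 (f z), f (L₀ y) = y :=
      (hs.hasStrictFDerivAt' hf' hn).eventually_right_inverse
    have h3 : ContinuousAt L₀ (f z) := (hs.to_localInverse hf' hn).continuousAt
    have h4 : ContinuousAt e (expOrbit p z) := continuousAt_extChartAt _
    have h5 : ContinuousAt (fun q => expOrbit p (L₀ (e q))) (expOrbit p z) := by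
      refine ContinuousAt.comp (g := expOrbit (n := n) p) ?_ (ContinuousAt.comp (g := L₀) h3 h4)
      exact (hM.contMDiff_expOrbit p).continuous.continuousAt
    -- The inverse function theorem only compares chart images; equality of the points themselves
    -- needs both to lie in the chart domain.
    have h6 : ∀ᶠ q in 𝓝 (expOrbit p z), expOrbit p (L₀ (e q)) ∈ e.source := by
      refine h5.eventually ?_
      have : expOrbit p (L₀ (e (expOrbit p z))) = expOrbit p z := congrArg _ h1
      change ∀ᶠ y in 𝓝 (expOrbit p (L₀ (e (expOrbit p z)))), y ∈ e.source
      rw [this]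
      exact extChartAt_source_mem_nhds (I := 𝓘(ℝ, Cn n)) _
    filter_upwards [h4.eventually h2, h6,
      extChartAt_source_mem_nhds (I := 𝓘(ℝ, Cn n)) (expOrbit p z)] with q hq1 hq2 hq3
    exact e.injOn hq2 hq3 hq1

/-- An orbit with nondegenerate parametrization is open, hence is the dense orbit. -/
theorem mem_orbit_of_injective {p₀ p : M}
    (hp₀ : IsOpen (MulAction.orbit (ComplexTorus n) p₀))
    (h : ∀ u, diffAt (n := n) (expOrbit (n := n) p) 0 u = 0 → u = 0) :
    p ∈ MulAction.orbit (ComplexTorus n) p₀ := by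
  obtain ⟨L, -, -, hL⟩ := hM.exists_local_inverse h
  rw [expOrbit_zero] at hL
  obtain ⟨q, hq1, hq2⟩ := mem_closure_iff_nhds.1 (hM.dense_orbit hp₀ p) _ hL
  have h1 : q ∈ MulAction.orbit (ComplexTorus n) p := by
    rw [← hq1]
    exact expOrbit_mem_orbit p _
  rw [← MulAction.orbit_eq_iff.2 hq2, MulAction.orbit_eq_iff.2 h1]
  exact MulAction.mem_orbit_self p

end IsToric

end ToricGeometry

/-! ### The metric, orbit volumes and Ricci curvature in terms of the moment map. -/

noncomputable section MomentMaps

open scoped Topology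

variable {n : ℕ} {M : Type*} [TopologicalSpace M] [ChartedSpace (Cn n) M]
  [MulAction (ComplexTorus n) M]

/-- The moment map along the orbit of `p`, in logarithmic coordinates. -/
def logMoment (μ : M → ((Fin n → ℝ) →L[ℝ] ℝ)) (p : M) (x : Fin n → ℝ) : (Fin n → ℝ) →L[ℝ] ℝ :=
  μ (expOrbit p (ofRealL n x))

/-- The metric along the orbit of `p`, in logarithmic coordinates. -/
def orbitMetric (μ : M → ((Fin n → ℝ) →L[ℝ] ℝ)) (p : M) (x : Fin n → ℝ) :
    (Fin n → ℝ) →L[ℝ] (Fin n → ℝ) →L[ℝ] ℝ :=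
  -fderiv ℝ (logMoment μ p) x

variable [IsManifold 𝓘(ℂ, Cn n) ω M]

theorem IsToric.fundamentalField_expOrbit (hM : IsToric n M) (p : M) (z : Cn n) (X : Fin n → ℝ) :
    fundamentalField X (expOrbit p z) = diffAt (n := n) (expOrbit (n := n) p) z (ofImagL n X) := by
  have h1 : HasFDerivAt (fun s : ℝ => z + s • ofImagL n X)
      (ContinuousLinearMap.toSpanSingleton ℝ (ofImagL n X)) 0 := by
    have := ((hasDerivAt_id (0 : ℝ)).smul_const (ofImagL n X)).const_add z
    simpa using this.hasFDerivAt
  have h2 := diffAt_comp (F := expOrbit (n := n) p) (hM.mdifferentiable_expOrbit p _)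
    h1.differentiableAt
  simp only [zero_smul, add_zero] at h2
  simp only [fundamentalField, expImag_smul_expOrbit, map_smul]
  rw [h2, h1.fderiv]
  simp

namespace IsMomentMap

variable {g : RiemMetric n M} {μ : M → ((Fin n → ℝ) →L[ℝ] ℝ)} (hμ : IsMomentMap g μ)

include hμ

theorem apply_expOrbit (p : M) (z : Cn n) : μ (expOrbit p z) = logMoment μ p (reL n z) := by
  conv_lhs => rw [← ofRealL_add_ofImagL z]
  rw [← expImag_smul_expOrbit, hμ.equivariant]
  rfl

theorem logMoment_expOrbit (p : M) (z : Cn n) (x : Fin n → ℝ) :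
    logMoment μ (expOrbit p z) x = logMoment μ p (reL n z + x) := by
  rw [logMoment, ← expOrbit_add, hμ.apply_expOrbit, map_add, reL_ofRealL]

/-- Allows the base point to be moved along the orbit, so that volumes and variations need only be
studied at x = 0. -/
theorem orbitMetric_expOrbit (p : M) (z : Cn n) (x : Fin n → ℝ) :
    orbitMetric μ (expOrbit p z) x = orbitMetric μ p (reL n z + x) := by
  have h1 : logMoment μ (expOrbit p z) = fun x => logMoment μ p (reL n z + x) :=
    funext (hμ.logMoment_expOrbit p z)
  rw [orbitMetric, h1, fderiv_comp_add_left, orbitMetric]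

variable (hM : IsToric n M)

include hM

theorem contDiff_logMoment (p : M) : ContDiff ℝ ∞ (logMoment μ p) := by
  rw [← contMDiff_iff_contDiff]
  exact hμ.smooth.comp ((hM.contMDiff_expOrbit p).comp (ofRealL n).contDiff.contMDiff)

theorem contDiff_orbitMetric (p : M) : ContDiff ℝ ∞ (orbitMetric μ p) :=
  ((hμ.contDiff_logMoment hM p).fderiv_right (by simp)).neg

theorem hasFDerivAt_logMoment (p : M) (x : Fin n → ℝ) :
    HasFDerivAt (logMoment μ p) (fderiv ℝ (logMoment μ p) x) x :=
  ((hμ.contDiff_logMoment hM p).differentiable (by simp) x).hasFDerivAt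

theorem momentDiffAt_diffAt (p : M) (z u : Cn n) :
    momentDiffAt μ (expOrbit p z) (diffAt (n := n) (expOrbit (n := n) p) z u)
      = fderiv ℝ (logMoment μ p) (reL n z) (reL n u) := by
  have h1 := (hμ.smooth.mdifferentiable (by simp) (expOrbit p z)).hasMFDerivAt.comp z
    (hM.mdifferentiable_expOrbit p z).hasMFDerivAt
  have h2 : HasFDerivAt (μ ∘ expOrbit (n := n) p) (momentDiffAt μ (expOrbit p z) ∘L
      diffAt (n := n) (expOrbit (n := n) p) z) z := hasMFDerivAt_iff_hasFDerivAt.1 h1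
  have h3 : HasFDerivAt (μ ∘ expOrbit (n := n) p) _ z :=
    ((hμ.hasFDerivAt_logMoment hM p (reL n z)).comp z (reL n).hasFDerivAt).congr_of_eventuallyEq
      (Filter.Eventually.of_forall fun w => hμ.apply_expOrbit p w)
  exact congrArg (fun L : Cn n →L[ℝ] _ => L u) (h2.unique h3)

variable (hg : IsKahler g)

include hg

/-- The fundamental field of X is the image of iX, and J sends it to the image of -X; thus ω(X̃, ·)
is minus the metric paired with the real direction X. -/
theorem pullbackMetric_ofRealL_left (p : M) (z u : Cn n) (X : Fin n → ℝ) :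
    pullbackMetric g (expOrbit (n := n) p) z (ofRealL n X) u =
      -fderiv ℝ (logMoment μ p) (reL n z) (reL n u) X := by
  have h1 := hμ.deriv_eq (expOrbit p z) X (diffAt (n := n) (expOrbit (n := n) p) z u)
  rw [hμ.momentDiffAt_diffAt hM, hM.fundamentalField_expOrbit, kahlerForm,
    ← hM.diffAt_expOrbit_I] at h1
  have h2 : Complex.I • ofImagL n X = -ofRealL n X := by
    ext i
    simp [← mul_assoc]
  rw [h1, h2, map_neg, map_neg, neg_apply, neg_neg]
  rfl

/-- Imaginary directions reduce to real ones because J is an isometry. The formula holds for every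
orbit, also a degenerate one, which matters for the maximum over M. -/
theorem pullbackMetric_expOrbit (p : M) (z : Cn n) :
    pullbackMetric g (expOrbit (n := n) p) z = tubeMetric (orbitMetric μ p) z := by
  have h1 : ∀ (X : Fin n → ℝ) (v : Cn n), pullbackMetric g (expOrbit (n := n) p) z (ofImagL n X) v =
      -fderiv ℝ (logMoment μ p) (reL n z) (imL n v) X := by
    intro X v
    have h2 : ofRealL n X = -(Complex.I • ofImagL n X) := by
      ext i
      simp [← mul_assoc]
    have h3 : imL n v = -reL n (Complex.I • v) := by
      ext i
      simp
    have h4 := hμ.pullbackMetric_ofRealL_left hM hg p z (Complex.I • v) X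
    rw [h3, map_neg, neg_apply, ← h4, h2, map_neg, neg_apply, neg_neg, pullbackMetric_apply,
      pullbackMetric_apply, hM.diffAt_expOrbit_I, hM.diffAt_expOrbit_I, hg.isometry_J]
  ext u v
  rw [pullbackMetric_symm, tubeMetric_apply]
  conv_lhs => rw [← ofRealL_add_ofImagL v]
  rw [map_add, add_apply, h1, hμ.pullbackMetric_ofRealL_left hM hg]
  rfl

theorem orbitMetric_apply (p : M) (x u v : Fin n → ℝ) : orbitMetric μ p x u v =
    pullbackMetric g (expOrbit (n := n) p) (ofRealL n x) (ofRealL n u) (ofRealL n v) := by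
  rw [hμ.pullbackMetric_expOrbit hM hg, tubeMetric_apply]
  simp

theorem orbitMetric_symm (p : M) (x u v : Fin n → ℝ) :
    orbitMetric μ p x u v = orbitMetric μ p x v u := by
  rw [hμ.orbitMetric_apply hM hg, pullbackMetric_symm, hμ.orbitMetric_apply hM hg]

theorem pullbackMetric_orbitMap (p : M) (y : Fin n → ℝ) :
    pullbackMetric g (orbitMap p) y = orbitMetric μ p 0 := by
  rw [pullbackMetric_comp g (F := expOrbit (n := n) p) (Z := ofImagL n)
    (Filter.Eventually.of_forall fun y => orbitMap_eq p y) (hM.mdifferentiable_expOrbit p _)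
    (ofImagL n).differentiableAt, hμ.pullbackMetric_expOrbit hM hg]
  ext u v
  simp [tubeMetric_apply]

theorem torusVolume_orbitMap (p : M) : torusVolume g (orbitMap p) =
    (2 * Real.pi) ^ n * Real.sqrt (gram (orbitMetric μ p 0)).det := by
  have h1 : ∀ y : Fin n → ℝ, Real.sqrt (Matrix.det (Matrix.of fun i j : Fin n =>
      pullbackMetric g (orbitMap p) y (Pi.single i 1) (Pi.single j 1))) =
      Real.sqrt (gram (orbitMetric μ p 0)).det := fun y => by
    rw [hμ.pullbackMetric_orbitMap hM hg]
    rfl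
  simp only [torusVolume, h1]
  rw [MeasureTheory.setIntegral_const, smul_eq_mul, MeasureTheory.measureReal_def,
    Real.volume_Icc_pi_toReal fun i => by simpa using Real.pi_pos.le]
  simp

theorem orbitVolume_eq (p : M) (x : Fin n → ℝ) : orbitVolume g p x =
    (2 * Real.pi) ^ n * Real.sqrt (gram (orbitMetric μ p x)).det := by
  rw [orbitVolume, expReal_eq, hμ.torusVolume_orbitMap hM hg]
  change _ * Real.sqrt (gram (orbitMetric μ (expOrbit p (ofRealL n x)) 0)).det = _
  rw [hμ.orbitMetric_expOrbit, reL_ofRealL, add_zero]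

theorem torusVolume_expOrbit (p : M) (z : Cn n) :
    torusVolume g (orbitMap (expOrbit p z)) = orbitVolume g p (reL n z) := by
  rw [hμ.torusVolume_orbitMap hM hg, hμ.orbitMetric_expOrbit, add_zero, hμ.orbitVolume_eq hM hg]

/-- An orbit of positive `n`-volume has injective parametrization. -/
theorem diffAt_injective_of_det_ne_zero {p : M} (hp : (gram (orbitMetric μ p 0)).det ≠ 0)
    (u : Cn n) (hu : diffAt (n := n) (expOrbit (n := n) p) 0 u = 0) : u = 0 := by
  have h1 : ∀ v, pullbackMetric g (expOrbit (n := n) p) 0 u v = 0 := fun v => by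
    rw [pullbackMetric_apply, hu, map_zero, zero_apply]
  simp only [hμ.pullbackMetric_expOrbit hM hg, tubeMetric_apply, map_zero] at h1
  have h2 : ∀ a : Fin n → ℝ, (∀ b, orbitMetric μ p 0 a b = 0) → a = 0 := fun a ha => by
    refine Matrix.eq_zero_of_vecMul_eq_zero hp ?_
    ext j
    have h3 := ha (Pi.single j 1)
    rw [← sum_smul_single a] at h3
    simpa [Matrix.vecMul, dotProduct, gram] using h3
  refine eq_zero_of_reL_imL (h2 _ fun b => ?_) (h2 _ fun b => ?_)
  · simpa using h1 (ofRealL n b)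
  · simpa using h1 (ofImagL n b)

variable [T2Space M] {p₀ : M} (hp₀ : IsOpen (MulAction.orbit (ComplexTorus n) p₀))

include hp₀

/-- Positivity comes from the immersive parametrization of the open orbit, and symmetry of the
derivative from its being minus the second derivative of the moment map. -/
theorem isHessianMetric : IsHessianMetric (orbitMetric μ p₀) where
  smooth := hμ.contDiff_orbitMetric hM p₀
  symm := hμ.orbitMetric_symm hM hg p₀
  pos x u hu := by
    rw [hμ.orbitMetric_apply hM hg]
    refine pullbackMetric_pos g _ _ _ fun h => hu ?_
    have h1 := hM.diffAt_expOrbit_injective hp₀ h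
    rw [← reL_ofRealL u, h1, map_zero]
  deriv_symm x u v w := by
    have h1 : IsSymmSndFDerivAt ℝ (logMoment μ p₀) x :=
      (hμ.contDiff_logMoment hM p₀).contDiffAt.isSymmSndFDerivAt (by
        rw [minSmoothness_of_isRCLikeNormedField]
        exact WithTop.coe_le_coe.2 (le_top (a := (2 : ℕ∞))))
    have h2 : fderiv ℝ (orbitMetric μ p₀) x = -fderiv ℝ (fderiv ℝ (logMoment μ p₀)) x :=
      fderiv_fun_neg
    rw [h2]
    simp [h1.eq u v]

theorem det_gram_pos (x : Fin n → ℝ) : 0 < (gram (orbitMetric μ p₀ x)).det :=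
  (posDef_gram ((hμ.isHessianMetric hM hg hp₀).symm x)
    ((hμ.isHessianMetric hM hg hp₀).pos x)).det_pos

theorem orbitVolume_eq_exp (x : Fin n → ℝ) : orbitVolume g p₀ x =
    (2 * Real.pi) ^ n * Real.exp (logDensity (orbitMetric μ p₀) x) := by
  rw [hμ.orbitVolume_eq hM hg, logDensity, mul_comm (1 / 2 : ℝ), ← div_eq_mul_one_div,
    Real.exp_half, Real.exp_log (hμ.det_gram_pos hM hg hp₀ x)]

/-- Ricci is defined in the preferred chart at the point; ψ passes from that chart to logarithmic
coordinates, and P is the inverse of its differential. Signs of the Ricci form are unaffected by P.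
-/
theorem ricci_expOrbit (z : Cn n) : ∃ P : Cn n ≃L[ℝ] Cn n, ∀ u : Cn n,
    ricci g (expOrbit p₀ z) (P u) (P u) =
      -(fderiv ℝ (fderiv ℝ (logDensity (orbitMetric μ p₀))) (reL n z) (reL n u) (reL n u)
      + fderiv ℝ (fderiv ℝ (logDensity (orbitMetric μ p₀))) (reL n z) (imL n u) (imL n u)) := by
  have H := hμ.isHessianMetric hM hg hp₀
  obtain ⟨L, hL1, hL2, hL3⟩ := hM.exists_local_inverse (z := z)
    fun u => hM.diffAt_expOrbit_injective hp₀
  set q := expOrbit p₀ z with hq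
  set x := extChartAt 𝓘(ℝ, Cn n) q q with hx
  set ψ : Cn n → Cn n := fun y => L (chartInv q y) with hψ
  have hqx : chartInv q x = q := extChartAt_to_inv (I := 𝓘(ℝ, Cn n)) q
  have hψx : ψ x = z := by rw [hψ]; simp only [hqx, hL1]
  have hc : ContMDiffAt 𝓘(ℝ, Cn n) 𝓘(ℝ, Cn n) ∞ (chartInv (n := n) q) x :=
    (contMDiffOn_extChartAt_symm q).contMDiffAt (extChartAt_target_mem_nhds q)
  have hψs : ContDiffAt ℝ 3 ψ x := by
    rw [← contMDiffAt_iff_contDiffAt]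
    refine ContMDiffAt.comp (g := L) x ?_
      (hc.of_le (WithTop.coe_le_coe.2 (le_top (a := (3 : ℕ∞)))))
    rw [hqx]
    exact hL2
  have hev : ∀ᶠ y in 𝓝 x, chartInv q y = expOrbit p₀ (ψ y) := by
    have h1 : Filter.Tendsto (chartInv (n := n) q) (𝓝 x) (𝓝 q) := by
      have := hc.continuousAt.tendsto
      rwa [hqx] at this
    exact (h1.eventually hL3).mono fun y hy => hy.symm
  -- The chart composed with the orbit parametrization is a left inverse of ψ near x.
  have hinj : ∀ u, fderiv ℝ ψ x u = 0 → u = 0 := fun u hu => by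
    have h1 : HasFDerivAt (fun w => extChartAt 𝓘(ℝ, Cn n) (expOrbit p₀ (ψ x)) (expOrbit p₀ w))
        (diffAt (n := n) (expOrbit (n := n) p₀) (ψ x)) (ψ x) :=
      hasFDerivAt_extChartAt_comp (hM.mdifferentiable_expOrbit p₀ (ψ x))
    have h2 := h1.comp x (hψs.differentiableAt (by norm_num)).hasFDerivAt
    rw [hψx, ← hq] at h2
    have h3 : HasFDerivAt (fun y : Cn n => y) (ContinuousLinearMap.id ℝ (Cn n)) x :=
      hasFDerivAt_id x
    have h4 : (fun y : Cn n => y) =ᶠ[𝓝 x]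
        (fun w => extChartAt 𝓘(ℝ, Cn n) q (expOrbit p₀ w)) ∘ ψ := by
      filter_upwards [hev, extChartAt_target_mem_nhds (I := 𝓘(ℝ, Cn n)) q] with y hy1 hy2
      rw [Function.comp_apply, ← hy1]
      exact ((extChartAt 𝓘(ℝ, Cn n) q).right_inv hy2).symm
    have h5 := congrArg (fun T : Cn n →L[ℝ] Cn n => T u)
      (h3.unique (h2.congr_of_eventuallyEq h4))
    simp only [ContinuousLinearMap.id_apply, ContinuousLinearMap.comp_apply, hu, map_zero] at h5
    exact h5
  have hP := (fderiv ℝ ψ x).isInvertible_of_injective rfl hinj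
  have hG : ∀ᶠ y in 𝓝 x, pullbackMetric g (chartInv q) y =
      (tubeMetric (orbitMetric μ p₀) (ψ y)).bilinearComp (fderiv ℝ ψ y) (fderiv ℝ ψ y) := by
    filter_upwards [hev.eventually_nhds, hψs.eventually (by norm_num)] with y hy1 hy2
    rw [pullbackMetric_comp g (F := expOrbit (n := n) p₀) (Z := ψ) hy1
      (hM.mdifferentiable_expOrbit p₀ _) (hy2.differentiableAt (by norm_num)),
      hμ.pullbackMetric_expOrbit hM hg]
  obtain ⟨P, hPe⟩ := id hP
  refine ⟨P.symm, fun u => ?_⟩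
  have h1 := localRicci_pullback (H.contDiff_tubeMetric.contDiffAt.of_le
    (WithTop.coe_le_coe.2 (le_top (a := (2 : ℕ∞))))) H.tubeMetric_symm H.tubeMetric_pos hψs hP hG
    (P.symm u) (P.symm u)
  have h2 : fderiv ℝ ψ x (P.symm u) = u := by
    rw [← hPe]
    simp
  rw [ricci, h1, h2, hψx, H.localRicci_tubeMetric]

end IsMomentMap

end MomentMaps

/-! ### Convexity of the volume function and maximal orbits. -/

noncomputable section Convexity

open scoped Topology

section Calculus

variable {n : ℕ} {f : (Fin n → ℝ) → ℝ}

theorem ContDiff.hasFDerivAt_fderiv (hf : ContDiff ℝ 2 f) (x : Fin n → ℝ) :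
    HasFDerivAt (fderiv ℝ f) (fderiv ℝ (fderiv ℝ f) x) x :=
  ((hf.fderiv_right (m := 1) (by norm_num)).differentiable (by norm_num) x).hasFDerivAt

theorem fderiv_const_mul_exp (hf : ContDiff ℝ 2 f) (C : ℝ) (x : Fin n → ℝ) :
    fderiv ℝ (fun y => C * Real.exp (f y)) x = (C * Real.exp (f x)) • fderiv ℝ f x := by
  have h1 := (hf.differentiable (by norm_num) x).hasFDerivAt.exp.const_mul C
  rw [h1.fderiv, smul_smul]

theorem fderiv_fderiv_const_mul_exp (hf : ContDiff ℝ 2 f) (C : ℝ) (x u : Fin n → ℝ) :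
    fderiv ℝ (fderiv ℝ fun y => C * Real.exp (f y)) x u u =
      C * Real.exp (f x) * (fderiv ℝ f x u ^ 2 + fderiv ℝ (fderiv ℝ f) x u u) := by
  have h1 : fderiv ℝ (fun y => C * Real.exp (f y)) = fun y =>
      (C * Real.exp (f y)) • fderiv ℝ f y := funext (fderiv_const_mul_exp hf C)
  have h2 := ((hf.differentiable (by norm_num) x).hasFDerivAt.exp.const_mul C).smul
    (hf.hasFDerivAt_fderiv x)
  rw [h1]
  refine (congrArg (fun T => T u u) h2.fderiv).trans ?_
  simp
  ring

theorem hasDerivAt_line (a u : Fin n → ℝ) (t : ℝ) : HasDerivAt (fun s : ℝ => a + s • u) u t := by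
  simpa using ((hasDerivAt_id t).smul_const u).const_add a

theorem ContDiff.hasDerivAt_comp_line (hf : ContDiff ℝ 2 f) (a u : Fin n → ℝ) (t : ℝ) :
    HasDerivAt (fun s : ℝ => f (a + s • u)) (fderiv ℝ f (a + t • u) u) t := by
  have h1 := (hf.differentiable (by norm_num) (a + t • u)).hasFDerivAt
  exact HasFDerivAt.comp_hasDerivAt (f := fun s : ℝ => a + s • u) t h1 (hasDerivAt_line a u t)

theorem ContDiff.hasDerivAt_fderiv_comp_line (hf : ContDiff ℝ 2 f) (a u : Fin n → ℝ) (t : ℝ) :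
    HasDerivAt (fun s : ℝ => fderiv ℝ f (a + s • u) u)
      (fderiv ℝ (fderiv ℝ f) (a + t • u) u u) t := by
  have h1 := (hf.hasFDerivAt_fderiv (a + t • u)).clm_apply (hasFDerivAt_const u (a + t • u))
  have h2 := HasFDerivAt.comp_hasDerivAt (f := fun s : ℝ => a + s • u) t h1 (hasDerivAt_line a u t)
  exact h2.congr_deriv (by simp)

/-- Rolle's theorem for the directional derivative along the segment from a to b. -/
theorem eq_of_fderiv_eq_zero_of_hess_neg (hf : ContDiff ℝ 2 f)
    (hn : ∀ x u : Fin n → ℝ, u ≠ 0 → fderiv ℝ (fderiv ℝ f) x u u < 0) {a b : Fin n → ℝ}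
    (ha : fderiv ℝ f a = 0) (hb : fderiv ℝ f b = 0) : a = b := by
  by_contra hab
  obtain ⟨c, -, hc⟩ := exists_hasDerivAt_eq_zero (zero_lt_one (α := ℝ))
    (fun t _ => (hf.hasDerivAt_fderiv_comp_line a (b - a) t).continuousAt.continuousWithinAt)
    (by simp [ha, hb]) (fun t _ => hf.hasDerivAt_fderiv_comp_line a (b - a) t)
  exact (hn _ _ (sub_ne_zero.2 (Ne.symm hab))).ne hc

/-- At a maximum the derivative vanishes; two applications of the mean value theorem along a line
through it then give a nonpositive second derivative somewhere. -/
theorem exists_lt_of_hess_pos (hf : ContDiff ℝ 2 f)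
    (hp : ∀ x u : Fin n → ℝ, u ≠ 0 → 0 < fderiv ℝ (fderiv ℝ f) x u u) (hn : 0 < n)
    (a : Fin n → ℝ) : ∃ b, f a < f b := by
  by_contra! hmax
  have h0 : fderiv ℝ f a = 0 :=
    IsLocalMax.fderiv_eq_zero (Filter.Eventually.of_forall hmax)
  set u : Fin n → ℝ := Pi.single ⟨0, hn⟩ 1
  have hu : u ≠ 0 := by simp [u]
  obtain ⟨c, hc, hc'⟩ := exists_hasDerivAt_eq_slope _ _ (zero_lt_one (α := ℝ))
    (fun t _ => (hf.hasDerivAt_comp_line a u t).continuousAt.continuousWithinAt)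
    (fun t _ => hf.hasDerivAt_comp_line a u t)
  obtain ⟨d, -, hd⟩ := exists_hasDerivAt_eq_slope _ _ hc.1
    (fun t _ => (hf.hasDerivAt_fderiv_comp_line a u t).continuousAt.continuousWithinAt)
    (fun t _ => hf.hasDerivAt_fderiv_comp_line a u t)
  have h1 : fderiv ℝ f (a + c • u) u ≤ 0 := by
    have := hmax (a + u)
    rw [hc']
    simpa using this
  have h2 := hp (a + d • u) u hu
  rw [hd] at h2
  simp only [zero_smul, add_zero, h0, zero_apply, sub_zero] at h2
  exact absurd h2 (not_lt.2 (div_nonpos_of_nonpos_of_nonneg h1 hc.1.le))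

end Calculus

variable {n : ℕ} {M : Type*} [TopologicalSpace M] [ChartedSpace (Cn n) M]
  [MulAction (ComplexTorus n) M] [IsManifold 𝓘(ℂ, Cn n) ω M]

namespace IsMomentMap

variable {g : RiemMetric n M} {μ : M → ((Fin n → ℝ) →L[ℝ] ℝ)} (hμ : IsMomentMap g μ)
  (hM : IsToric n M)

include hμ hM

/-- The moment map composed with the action is jointly smooth in the point and x, so its
x-derivative at 0 depends continuously on the point, across orbits of all dimensions. -/
theorem continuous_orbitMetric : Continuous fun p : M => orbitMetric μ p 0 := by
  refine continuous_iff_continuousAt.2 fun p => ContinuousAt.neg ?_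
  set e := extChartAt 𝓘(ℝ, Cn n) p with he
  set f : Cn n → (Fin n → ℝ) → ((Fin n → ℝ) →L[ℝ] ℝ) :=
    fun y => logMoment μ (chartInv p y) with hf
  have h1 : ContDiffAt ℝ 1 (Function.uncurry f) (e p, 0) := by
    rw [← contMDiffAt_iff_contDiffAt]
    have hc : ContMDiffAt 𝓘(ℝ, Cn n) 𝓘(ℝ, Cn n) ∞ (chartInv (n := n) p) (e p) :=
      (contMDiffOn_extChartAt_symm p).contMDiffAt (extChartAt_target_mem_nhds p)
    have h2 : ContMDiffAt 𝓘(ℝ, Cn n × (Fin n → ℝ)) (𝓘(ℝ, Cn n).prod 𝓘(ℝ, Cn n)) ∞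
        (fun w : Cn n × (Fin n → ℝ) => (ofRealL n w.2, chartInv p w.1)) (e p, 0) := by
      refine ContMDiffAt.prodMk ?_ ?_
      · exact ((ofRealL n).contDiff.comp contDiff_snd).contMDiff.contMDiffAt
      · exact ContMDiffAt.comp (g := chartInv (n := n) p)
          (f := (Prod.fst : Cn n × (Fin n → ℝ) → Cn n)) _ hc
          contDiff_fst.contMDiff.contMDiffAt
    exact ((hμ.smooth.comp hM.contMDiff_action).contMDiffAt.comp _ h2).of_le
      (WithTop.coe_le_coe.2 (le_top (a := (1 : ℕ∞))))
  have h3 : ContinuousAt (fun y => fderiv ℝ (f y) 0) (e p) :=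
    (ContDiffAt.fderiv (m := 0) h1 contDiffAt_const (by norm_num)).continuousAt
  have h4 : ContinuousAt (fun q => fderiv ℝ (f (e q)) 0) p :=
    ContinuousAt.comp (f := e) (g := fun y => fderiv ℝ (f y) 0) h3 (continuousAt_extChartAt p)
  refine h4.congr ?_
  filter_upwards [extChartAt_source_mem_nhds (I := 𝓘(ℝ, Cn n)) p] with q hq
  have h5 : chartInv p (e q) = q := e.left_inv hq
  rw [hf]
  simp only [h5]

variable (hg : IsKahler g)

include hg

/-- J turns the imaginary orbit directions into real ones, which are orthogonal to imaginary ones in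
the tube metric. -/
theorem pullbackForm_orbitMap (p : M) (y u v : Fin n → ℝ) :
    pullbackForm g (orbitMap p) y u v = 0 := by
  have h1 : diffAt (n := n) (orbitMap (M := M) p) y =
      diffAt (n := n) (expOrbit (n := n) p) (ofImagL n y) ∘L ofImagL n := by
    have h2 := diffAt_comp (Z := ofImagL n) (x := y) (hM.mdifferentiable_expOrbit p _)
      (ofImagL n).differentiableAt
    rw [ContinuousLinearMap.fderiv] at h2
    rw [← h2]
    exact diffAt_congr (Filter.Eventually.of_forall fun y => orbitMap_eq p y)
  have h3 := hμ.pullbackMetric_expOrbit hM hg p (ofImagL n y)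
  have h4 := congrArg (fun T => T (Complex.I • ofImagL n u) (ofImagL n v)) h3
  have h5 : imL n (Complex.I • ofImagL n u) = 0 := by
    ext i
    simp
  simp only [tubeMetric_apply, reL_ofImagL, h5, map_zero, zero_apply, add_zero,
    pullbackMetric_apply, hM.diffAt_expOrbit_I] at h4
  rw [pullbackForm, kahlerForm, h1, orbitMap_eq]
  exact h4

variable [T2Space M] {p₀ : M} (hp₀ : IsOpen (MulAction.orbit (ComplexTorus n) p₀))

include hp₀

theorem isLagrangianTorus : IsLagrangianTorus g (orbitMap (n := n) p₀) where
  smooth := by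
    have h1 := (hM.contMDiff_expOrbit p₀).comp (ofImagL n).contDiff.contMDiff
    exact h1.congr fun y => orbitMap_eq p₀ y
  periodic y k := by
    have h1 : expImag (fun i => y i + 2 * Real.pi * (k i : ℝ)) = expImag y := by
      ext i
      simp only [expImag, torusExp, Units.val_mk0]
      refine Complex.exp_eq_exp_iff_exists_int.2 ⟨k i, ?_⟩
      push_cast
      ring
    rw [orbitMap, h1, orbitMap]
  injective y y' h := by
    have h1 : (expImag y)⁻¹ * expImag y' = 1 :=
      hM.eq_one_of_smul_eq hp₀ (by rw [mul_smul, inv_smul_eq_iff]; exact h.symm)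
    have h2 : expImag y' = expImag y := (inv_mul_eq_one.1 h1).symm
    have h3 : ∀ i, ∃ k : ℤ, y' i = y i + 2 * Real.pi * (k : ℝ) := fun i => by
      have h4 := congrArg Units.val (congrFun h2 i)
      simp only [expImag, torusExp, Units.val_mk0] at h4
      obtain ⟨k, hk⟩ := Complex.exp_eq_exp_iff_exists_int.1 h4
      refine ⟨k, ?_⟩
      have h5 := congrArg Complex.im hk
      simp at h5
      linarith
    choose k hk using h3
    exact ⟨k, funext hk⟩
  immersion y := by
    refine (injective_iff_map_eq_zero _).2 fun u hu => ?_
    by_contra h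
    have h1 := (hμ.isHessianMetric hM hg hp₀).pos 0 u h
    rw [← hμ.pullbackMetric_orbitMap hM hg p₀ y, pullbackMetric_apply, hu] at h1
    simp at h1
  lagrangian := hμ.pullbackForm_orbitMap hM hg p₀

theorem log_orbitVolume : (fun x => Real.log (orbitVolume g p₀ x)) =
    fun x => Real.log ((2 * Real.pi) ^ n) + logDensity (orbitMetric μ p₀) x := by
  funext x
  rw [hμ.orbitVolume_eq_exp hM hg hp₀, Real.log_mul (by positivity) (Real.exp_ne_zero _),
    Real.log_exp]

theorem contDiff_logDensity : ContDiff ℝ ∞ (logDensity (orbitMetric μ p₀)) :=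
  (hμ.isHessianMetric hM hg hp₀).contDiff_logDensity

theorem contDiff_two_logDensity : ContDiff ℝ 2 (logDensity (orbitMetric μ p₀)) :=
  (hμ.contDiff_logDensity hM hg hp₀).of_le (WithTop.coe_le_coe.2 (le_top (a := (2 : ℕ∞))))

theorem fderiv_fderiv_log_orbitVolume :
    fderiv ℝ (fderiv ℝ fun x => Real.log (orbitVolume g p₀ x)) =
      fderiv ℝ (fderiv ℝ (logDensity (orbitMetric μ p₀))) := by
  rw [hμ.log_orbitVolume hM hg hp₀]
  congr 1
  exact funext fun x => fderiv_const_add _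

theorem contDiff_log_orbitVolume : ContDiff ℝ 2 fun x => Real.log (orbitVolume g p₀ x) := by
  rw [hμ.log_orbitVolume hM hg hp₀]
  exact contDiff_const.add (hμ.contDiff_two_logDensity hM hg hp₀)

theorem orbitVolume_fun_eq : orbitVolume g p₀ = fun x =>
    (2 * Real.pi) ^ n * Real.exp (logDensity (orbitMetric μ p₀) x) :=
  funext (hμ.orbitVolume_eq_exp hM hg hp₀)

theorem contDiff_orbitVolume : ContDiff ℝ ∞ (orbitVolume g p₀) := by
  rw [hμ.orbitVolume_fun_eq hM hg hp₀]
  exact contDiff_const.mul (hμ.contDiff_logDensity hM hg hp₀).exp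

theorem orbitVolume_pos (x : Fin n → ℝ) : 0 < orbitVolume g p₀ x := by
  rw [hμ.orbitVolume_eq_exp hM hg hp₀]
  positivity

theorem ricciPositiveOn_iff : RicciPositiveOn g (MulAction.orbit (ComplexTorus n) p₀) ↔
    HessStrictlyConcave fun x => Real.log (orbitVolume g p₀ x) := by
  rw [HessStrictlyConcave, and_iff_right (hμ.contDiff_log_orbitVolume hM hg hp₀),
    hμ.fderiv_fderiv_log_orbitVolume hM hg hp₀]
  constructor
  · intro h x u hu
    obtain ⟨P, hP⟩ := hμ.ricci_expOrbit hM hg hp₀ (ofRealL n x)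
    have h1 := h _ (expOrbit_mem_orbit p₀ (ofRealL n x)) (P (ofRealL n u)) fun h0 => hu <| by
      rw [← reL_ofRealL u, (map_eq_zero_iff P P.injective).1 h0, map_zero]
    rw [hP] at h1
    simpa using h1
  · intro h p hp u hu
    rw [orbit_eq_range_expOrbit] at hp
    obtain ⟨z, rfl⟩ := hp
    obtain ⟨P, hP⟩ := hμ.ricci_expOrbit hM hg hp₀ z
    obtain ⟨v, rfl⟩ := P.surjective u
    have hv : v ≠ 0 := fun h0 => hu (by rw [h0, map_zero])
    have h0 : ∀ w, fderiv ℝ (fderiv ℝ (logDensity (orbitMetric μ p₀))) (reL n z) w w ≤ 0 := by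
      intro w
      rcases eq_or_ne w 0 with rfl | hw
      · simp
      · exact (h _ w hw).le
    rw [hP, neg_pos]
    -- A nonzero vector has a nonzero real or imaginary part, and that part makes the inequality
    -- strict.
    by_cases h1 : reL n v = 0
    · exact add_neg_of_nonpos_of_neg (h0 _) (h _ _ fun h2 => hv (eq_zero_of_reL_imL h1 h2))
    · exact add_neg_of_neg_of_nonpos (h _ _ h1) (h0 _)

theorem ricciNegativeOn_iff : RicciNegativeOn g (MulAction.orbit (ComplexTorus n) p₀) ↔
    HessStrictlyConvex fun x => Real.log (orbitVolume g p₀ x) := by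
  rw [HessStrictlyConvex, and_iff_right (hμ.contDiff_log_orbitVolume hM hg hp₀),
    hμ.fderiv_fderiv_log_orbitVolume hM hg hp₀]
  constructor
  · intro h x u hu
    obtain ⟨P, hP⟩ := hμ.ricci_expOrbit hM hg hp₀ (ofRealL n x)
    have h1 := h _ (expOrbit_mem_orbit p₀ (ofRealL n x)) (P (ofRealL n u)) fun h0 => hu <| by
      rw [← reL_ofRealL u, (map_eq_zero_iff P P.injective).1 h0, map_zero]
    rw [hP] at h1
    simpa using h1
  · intro h p hp u hu
    rw [orbit_eq_range_expOrbit] at hp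
    obtain ⟨z, rfl⟩ := hp
    obtain ⟨P, hP⟩ := hμ.ricci_expOrbit hM hg hp₀ z
    obtain ⟨v, rfl⟩ := P.surjective u
    have hv : v ≠ 0 := fun h0 => hu (by rw [h0, map_zero])
    have h0 : ∀ w, 0 ≤ fderiv ℝ (fderiv ℝ (logDensity (orbitMetric μ p₀))) (reL n z) w w := by
      intro w
      rcases eq_or_ne w 0 with rfl | hw
      · simp
      · exact (h _ w hw).le
    rw [hP, neg_lt_zero]
    by_cases h1 : reL n v = 0
    · exact add_pos_of_nonneg_of_pos (h0 _) (h _ _ fun h2 => hv (eq_zero_of_reL_imL h1 h2))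
    · exact add_pos_of_pos_of_nonneg (h _ _ h1) (h0 _)

theorem hessStrictlyConvex_one_div_orbitVolume
    (h : ∀ x u, u ≠ 0 → fderiv ℝ (fderiv ℝ (logDensity (orbitMetric μ p₀))) x u u < 0) :
    HessStrictlyConvex fun x => 1 / orbitVolume g p₀ x := by
  have hl := hμ.contDiff_two_logDensity hM hg hp₀
  have h1 : (fun x => 1 / orbitVolume g p₀ x) = fun x =>
      ((2 * Real.pi) ^ n)⁻¹ * Real.exp (-logDensity (orbitMetric μ p₀) x) := by
    funext x
    rw [hμ.orbitVolume_eq_exp hM hg hp₀, one_div, mul_inv, Real.exp_neg]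
  rw [h1]
  refine ⟨contDiff_const.mul hl.neg.exp, fun x u hu => ?_⟩
  have h2 : fderiv ℝ (fderiv ℝ fun y => -logDensity (orbitMetric μ p₀) y) =
      -fderiv ℝ (fderiv ℝ (logDensity (orbitMetric μ p₀))) := by
    have h3 : (fderiv ℝ fun y => -logDensity (orbitMetric μ p₀) y) =
        fun y => -fderiv ℝ (logDensity (orbitMetric μ p₀)) y := funext fun y => fderiv_fun_neg
    rw [h3]
    exact funext fun y => fderiv_fun_neg
  rw [fderiv_fderiv_const_mul_exp hl.neg, h2]
  refine mul_pos (by positivity) (add_pos_of_nonneg_of_pos (sq_nonneg _) ?_)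
  simpa using h x u hu

theorem hessStrictlyConvex_orbitVolume
    (h : ∀ x u, u ≠ 0 → 0 < fderiv ℝ (fderiv ℝ (logDensity (orbitMetric μ p₀))) x u u) :
    HessStrictlyConvex (orbitVolume g p₀) := by
  have hl := hμ.contDiff_two_logDensity hM hg hp₀
  rw [hμ.orbitVolume_fun_eq hM hg hp₀]
  refine ⟨contDiff_const.mul hl.exp, fun x u hu => ?_⟩
  rw [fderiv_fderiv_const_mul_exp hl]
  exact mul_pos (by positivity) (add_pos_of_nonneg_of_pos (sq_nonneg _) (h x u hu))

theorem fderiv_orbitVolume_eq_zero_iff (x : Fin n → ℝ) : fderiv ℝ (orbitVolume g p₀) x = 0 ↔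
    fderiv ℝ (logDensity (orbitMetric μ p₀)) x = 0 := by
  rw [hμ.orbitVolume_fun_eq hM hg hp₀,
    fderiv_const_mul_exp (hμ.contDiff_two_logDensity hM hg hp₀), smul_eq_zero_iff_right]
  positivity

/-- The Gram determinant is continuous on the compact M. Its maximum dominates the positive value at
`p₀`, so the maximizing orbit is nondegenerate and must be the dense one. -/
theorem exists_forall_torusVolume_le [CompactSpace M] :
    ∃ x₀ : Fin n → ℝ, ∀ p : M, torusVolume g (orbitMap p) ≤ orbitVolume g p₀ x₀ := by
  have : Nonempty M := ⟨p₀⟩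
  have hc : Continuous fun p : M => (gram (orbitMetric μ p 0)).det := by
    refine Continuous.matrix_det (continuous_matrix fun i j => ?_)
    exact ((hμ.continuous_orbitMetric hM).clm_apply continuous_const).clm_apply continuous_const
  obtain ⟨p, -, hp⟩ := isCompact_univ.exists_isMaxOn Set.univ_nonempty hc.continuousOn
  have hp' : ∀ q : M, (gram (orbitMetric μ q 0)).det ≤ (gram (orbitMetric μ p 0)).det :=
    fun q => hp (Set.mem_univ q)
  have h1 : p ∈ MulAction.orbit (ComplexTorus n) p₀ :=
    hM.mem_orbit_of_injective hp₀ (hμ.diffAt_injective_of_det_ne_zero hM hg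
      ((hμ.det_gram_pos hM hg hp₀ 0).trans_le (hp' p₀)).ne')
  rw [orbit_eq_range_expOrbit] at h1
  obtain ⟨z, rfl⟩ := h1
  refine ⟨reL n z, fun q => ?_⟩
  rw [← hμ.torusVolume_expOrbit hM hg, hμ.torusVolume_orbitMap hM hg,
    hμ.torusVolume_orbitMap hM hg]
  exact mul_le_mul_of_nonneg_left (Real.sqrt_le_sqrt (hp' q)) (by positivity)

theorem exists_forall_logDensity_le [CompactSpace M] :
    ∃ x₀ : Fin n → ℝ, (∀ p : M, torusVolume g (orbitMap p) ≤ orbitVolume g p₀ x₀) ∧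
      ∀ x, logDensity (orbitMetric μ p₀) x ≤ logDensity (orbitMetric μ p₀) x₀ := by
  obtain ⟨x₀, hx₀⟩ := hμ.exists_forall_torusVolume_le hM hg hp₀
  refine ⟨x₀, hx₀, fun x => ?_⟩
  have h1 : orbitVolume g p₀ x ≤ orbitVolume g p₀ x₀ := hx₀ _
  rw [hμ.orbitVolume_eq_exp hM hg hp₀, hμ.orbitVolume_eq_exp hM hg hp₀] at h1
  exact Real.exp_le_exp.1 (le_of_mul_le_mul_left h1 (by positivity))

end IsMomentMap

end Convexity

/-! ### First variation of the volume of a torus orbit. -/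

noncomputable section FirstVariation

open scoped Topology
open MeasureTheory

variable {n : ℕ}

/-- The integral of the divergence of a periodic vector field over a period cell vanishes. -/
theorem integral_trace_fderiv_eq_zero {η : (Fin n → ℝ) → (Fin n → ℝ)} (hη : ContDiff ℝ 1 η)
    (hper : IsPeriodic η) :
    ∫ y in Set.Icc (0 : Fin n → ℝ) (fun _ => 2 * Real.pi), traceCLM n (fderiv ℝ η y) = 0 := by
  -- The divergence theorem is applied on boxes in dimension n + 1; in dimension zero the trace is
  -- an empty sum.
  rcases n with _ | n
  · simp [traceCLM_apply]
  have hc : Continuous (fderiv ℝ η) := hη.continuous_fderiv (by norm_num)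
  have h1 := integral_divergence_of_hasFDerivAt_off_countable (0 : Fin (n + 1) → ℝ)
    (fun _ => 2 * Real.pi) (fun i => by simpa using Real.pi_pos.le) η (fderiv ℝ η) ∅
    Set.countable_empty hη.continuous.continuousOn
    (fun y _ => (hη.differentiable (by norm_num) y).hasFDerivAt)
    (by
      refine ContinuousOn.integrableOn_compact isCompact_Icc (Continuous.continuousOn ?_)
      exact continuous_finsetSum _ fun i _ =>
        (continuous_apply i).comp (hc.clm_apply continuous_const))
  simp only [traceCLM_apply]
  rw [h1]
  refine Finset.sum_eq_zero fun i _ => sub_eq_zero.2 ?_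
  congr 1
  funext x
  -- Opposite faces differ by the period 2π in direction i, so their fluxes cancel.
  have h2 := hper (Fin.insertNth i ((0 : Fin (n + 1) → ℝ) i) x) (Pi.single i 1)
  refine congrFun ((congrArg η ?_).trans h2) i
  funext j
  rcases Fin.eq_self_or_eq_succAbove i j with rfl | ⟨k, rfl⟩
  · simp
  · simp

/-- Differentiation under the integral sign over a compact set. -/
theorem hasDerivAt_setIntegral_of_contDiffAt {V : Type*} [NormedAddCommGroup V] [NormedSpace ℝ V]
    [MeasurableSpace V] [BorelSpace V] (ν : Measure V) [IsFiniteMeasureOnCompacts ν] {K : Set V}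
    (hK : IsCompact K) {S : ℝ × V → ℝ} {O : Set (ℝ × V)} (hO : IsOpen O)
    (hKO : ∀ y ∈ K, ((0 : ℝ), y) ∈ O) (hS : ∀ w ∈ O, ContDiffAt ℝ 1 S w) :
    HasDerivAt (fun t => ∫ y in K, S (t, y) ∂ν)
      (∫ y in K, fderiv ℝ S (0, y) (1, 0) ∂ν) 0 := by
  -- Compactness of K yields one time interval valid for all its points, and with it a uniform bound
  -- on the derivative.
  obtain ⟨u, v, hu, -, hu0, hKv, huv⟩ := generalized_tube_lemma (s := {(0 : ℝ)}) (t := K)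
    isCompact_singleton hK hO (by
      rintro ⟨t, y⟩ ⟨ht, hy⟩
      obtain rfl : t = 0 := ht
      exact hKO y hy)
  obtain ⟨ε, hε, hεu⟩ := Metric.nhds_basis_closedBall.mem_iff.1 (hu.mem_nhds (hu0 rfl))
  have hsub : ∀ t ∈ Metric.closedBall (0 : ℝ) ε, ∀ y ∈ K, (t, y) ∈ O := fun t ht y hy =>
    huv ⟨hεu ht, hKv hy⟩
  have hF' : ContinuousOn (fun w => fderiv ℝ S w (1, 0)) O := fun w hw =>
    (((hS w hw).fderiv_right (m := 0) (by norm_num)).continuousAt.clm_apply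
      continuousAt_const).continuousWithinAt
  have hF : ContinuousOn S O := fun w hw => (hS w hw).continuousAt.continuousWithinAt
  obtain ⟨C, hC⟩ := ((isCompact_closedBall (0 : ℝ) ε).prod hK).exists_bound_of_continuousOn
    (hF'.mono fun w hw => hsub w.1 hw.1 w.2 hw.2)
  have hslice : ∀ {R : Type} [TopologicalSpace R] (f : ℝ × V → R), ContinuousOn f O →
      ∀ t ∈ Metric.closedBall (0 : ℝ) ε, ContinuousOn (fun y => f (t, y)) K :=
    fun f hf t ht => hf.comp (by fun_prop) fun y hy => hsub t ht y hy
  have h0 : (0 : ℝ) ∈ Metric.closedBall (0 : ℝ) ε := Metric.mem_closedBall_self hε.le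
  refine (hasDerivAt_integral_of_dominated_loc_of_deriv_le (bound := fun _ => C)
    (F := fun t y => S (t, y)) (F' := fun t y => fderiv ℝ S (t, y) (1, 0))
    (Metric.closedBall_mem_nhds (0 : ℝ) hε) ?_ ?_ ?_ ?_ ?_ ?_).2
  · filter_upwards [Metric.closedBall_mem_nhds (0 : ℝ) hε] with t ht
    exact (hslice S hF t ht).aestronglyMeasurable_of_isCompact hK hK.measurableSet
  · exact (hslice S hF 0 h0).integrableOn_compact hK
  · exact (hslice _ hF' 0 h0).aestronglyMeasurable_of_isCompact hK hK.measurableSet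
  · exact (ae_restrict_iff' hK.measurableSet).2 (Filter.Eventually.of_forall fun y hy t ht =>
      hC (t, y) ⟨ht, hy⟩)
  · exact continuousOn_const.integrableOn_compact hK
  · refine (ae_restrict_iff' hK.measurableSet).2 (Filter.Eventually.of_forall fun y hy t ht => ?_)
    have h1 := ((hS _ (hsub t ht y hy)).differentiableAt (by norm_num)).hasFDerivAt
    have h2 : HasDerivAt (fun s : ℝ => (s, y)) ((1 : ℝ), (0 : V)) t :=
      (hasDerivAt_id t).prodMk (hasDerivAt_const t y)
    exact HasFDerivAt.comp_hasDerivAt (f := fun s : ℝ => (s, y)) t h1 h2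

/-- The Gram matrices of the tori `y ↦ Z(t, y)`. -/
def gramAlong (h : (Fin n → ℝ) → ((Fin n → ℝ) →L[ℝ] (Fin n → ℝ) →L[ℝ] ℝ))
    (Z : ℝ × (Fin n → ℝ) → Cn n) (w : ℝ × (Fin n → ℝ)) : Matrix (Fin n) (Fin n) ℝ :=
  Matrix.of fun i j => tubeMetric h (Z w) (fderiv ℝ Z w (0, Pi.single i 1))
    (fderiv ℝ Z w (0, Pi.single j 1))

theorem fderiv_apply_inr {Z : ℝ × (Fin n → ℝ) → Cn n} (hZ0 : ∀ y, Z (0, y) = ofImagL n y)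
    {y : Fin n → ℝ} (hZ : DifferentiableAt ℝ Z (0, y)) (u : Fin n → ℝ) :
    fderiv ℝ Z (0, y) (0, u) = ofImagL n u := by
  have h1 : HasFDerivAt (fun y : Fin n → ℝ => ((0 : ℝ), y))
      (ContinuousLinearMap.inr ℝ ℝ (Fin n → ℝ)) y := hasFDerivAt_prodMk_right 0 y
  have h2 := HasFDerivAt.comp (g := Z) (f := fun y : Fin n → ℝ => ((0 : ℝ), y)) y
    hZ.hasFDerivAt h1
  have h3 : (Z ∘ fun y : Fin n → ℝ => ((0 : ℝ), y)) = ofImagL n := funext hZ0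
  rw [h3] at h2
  exact congrArg (fun T => T u) (h2.unique (ofImagL n).hasFDerivAt)

namespace IsHessianMetric

variable {h : (Fin n → ℝ) → ((Fin n → ℝ) →L[ℝ] (Fin n → ℝ) →L[ℝ] ℝ)} (H : IsHessianMetric h)
  {Z : ℝ × (Fin n → ℝ) → Cn n}

include H

theorem gramAlong_zero (hZ0 : ∀ y, Z (0, y) = ofImagL n y) {y : Fin n → ℝ}
    (hZ : DifferentiableAt ℝ Z (0, y)) : gramAlong h Z (0, y) = gram (h 0) := by
  ext i j
  simp [gramAlong, fderiv_apply_inr hZ0 hZ, hZ0, tubeMetric_apply, gram]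

/-- At t = 0 the tangent vectors are purely imaginary, so the real half of the tube metric is
quadratic in vanishing quantities and contributes nothing to first order. -/
theorem hasDerivAt_gramAlong (hZ0 : ∀ y, Z (0, y) = ofImagL n y) {y : Fin n → ℝ}
    (hZ : ContDiffAt ℝ 2 Z (0, y)) (i j : Fin n) :
    HasDerivAt (fun t => gramAlong h Z (t, y) i j)
      (fderiv ℝ h 0 (reL n (fderiv ℝ Z (0, y) (1, 0))) (Pi.single i 1) (Pi.single j 1)
        + h 0 (imL n (fderiv ℝ (fderiv ℝ Z) (0, y) (1, 0) (0, Pi.single i 1))) (Pi.single j 1)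
        + h 0 (Pi.single i 1) (imL n (fderiv ℝ (fderiv ℝ Z) (0, y) (1, 0) (0, Pi.single j 1)))) 0 := by
  have hl : HasDerivAt (fun s : ℝ => (s, y)) ((1 : ℝ), (0 : Fin n → ℝ)) 0 :=
    (hasDerivAt_id (0 : ℝ)).prodMk (hasDerivAt_const (0 : ℝ) y)
  have hZ' : HasFDerivAt Z (fderiv ℝ Z (0, y)) (0, y) :=
    (hZ.differentiableAt (by norm_num)).hasFDerivAt
  have hD : HasFDerivAt (fderiv ℝ Z) (fderiv ℝ (fderiv ℝ Z) (0, y)) (0, y) :=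
    ((hZ.fderiv_right (m := 1) (by norm_num)).differentiableAt (by norm_num)).hasFDerivAt
  have hb := fderiv_apply_inr hZ0 (hZ.differentiableAt (by norm_num))
  have hre : reL n (Z (0, y)) = 0 := by rw [hZ0, reL_ofImagL]
  have h1 : HasFDerivAt h (fderiv ℝ h 0) (reL n (Z (0, y))) := by
    rw [hre]
    exact H.hasFDerivAt 0
  have h2 := h1.comp (0, y) ((reL n).hasFDerivAt.comp (0, y) hZ')
  have h3 : ∀ (T : Cn n →L[ℝ] (Fin n → ℝ)) (u : Fin n → ℝ),
      HasFDerivAt (fun w => T (fderiv ℝ Z w (0, u))) _ (0, y) := fun T u =>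
    T.hasFDerivAt.comp (0, y) (hD.clm_apply (hasFDerivAt_const _ _))
  have h4 : ∀ T : Cn n →L[ℝ] (Fin n → ℝ), HasFDerivAt (fun w => h (reL n (Z w))
      (T (fderiv ℝ Z w (0, Pi.single i 1))) (T (fderiv ℝ Z w (0, Pi.single j 1)))) _ (0, y) :=
    fun T => (h2.clm_apply (h3 T (Pi.single i 1))).clm_apply (h3 T (Pi.single j 1))
  have h5 := HasFDerivAt.comp_hasDerivAt (f := fun s : ℝ => (s, y)) 0
    ((h4 (reL n)).add (h4 (imL n))) hl
  refine h5.congr_deriv ?_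
  simp [hb, hre]
  ring

/-- The real part ξ of the velocity contributes the derivative of the log density, zero by
criticality; the imaginary part η contributes its divergence. -/
theorem hasDerivAt_sqrt_det_gramAlong (hZ0 : ∀ y, Z (0, y) = ofImagL n y) {y : Fin n → ℝ}
    (hZ : ContDiffAt ℝ 2 Z (0, y)) (hcrit : fderiv ℝ (logDensity h) 0 = 0) :
    HasDerivAt (fun t => Real.sqrt (gramAlong h Z (t, y)).det) (Real.sqrt (gram (h 0)).det *
      traceCLM n (fderiv ℝ (fun y => imL n (fderiv ℝ Z (0, y) (1, 0))) y)) 0 := by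
  have hpos : 0 < (gram (h 0)).det := (posDef_gram (H.symm 0) (H.pos 0)).det_pos
  set η : (Fin n → ℝ) → (Fin n → ℝ) := fun y => imL n (fderiv ℝ Z (0, y) (1, 0)) with hη
  set ξ := reL n (fderiv ℝ Z (0, y) (1, 0)) with hξ
  have hs : IsSymmSndFDerivAt ℝ Z (0, y) := hZ.isSymmSndFDerivAt (by simp)
  have hD : HasFDerivAt (fderiv ℝ Z) (fderiv ℝ (fderiv ℝ Z) (0, y)) (0, y) :=
    ((hZ.fderiv_right (m := 1) (by norm_num)).differentiableAt (by norm_num)).hasFDerivAt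
  have hT : ∀ u, imL n (fderiv ℝ (fderiv ℝ Z) (0, y) (1, 0) (0, u)) = fderiv ℝ η y u := fun u => by
    have h1 : HasFDerivAt (fun y : Fin n → ℝ => ((0 : ℝ), y))
        (ContinuousLinearMap.inr ℝ ℝ (Fin n → ℝ)) y := hasFDerivAt_prodMk_right 0 y
    have h2 := HasFDerivAt.comp (f := fun y : Fin n → ℝ => ((0 : ℝ), y)) y
      ((imL n).hasFDerivAt.comp (0, y) (hD.clm_apply (hasFDerivAt_const (1, 0) (0, y)))) h1
    have h3 : HasFDerivAt η _ y := h2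
    rw [h3.fderiv, hs.eq]
    simp
  set T := fderiv ℝ η y with hTdef
  set P : Matrix (Fin n) (Fin n) ℝ := Matrix.of fun i k => T (Pi.single i 1) k with hP
  set B : Matrix (Fin n) (Fin n) ℝ := Matrix.of fun i k => christoffel h 0 ξ (Pi.single i 1) k with hB
  set m := gram (h 0) with hm
  have hm0 : gramAlong h Z (0, y) = m :=
    H.gramAlong_zero hZ0 (hZ.differentiableAt (by norm_num))
  have hmT : m.transpose = m := by
    ext i j
    exact H.symm _ _ _
  have hmu : IsUnit m.det := hpos.ne'.isUnit
  -- N is the Gram derivative factored through m: 2Bm is the derivative of h along ξ, Pm comes from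
  -- the first tangent vector, and its transpose m Pᵀ from the second.
  have h1 := hasDerivAt_det (N := (2 : ℝ) • B + P + m * P.transpose * m⁻¹)
    (fun i j => H.hasDerivAt_gramAlong hZ0 hZ i j) (m' := Matrix.of fun i j =>
      fderiv ℝ h 0 ξ (Pi.single i 1) (Pi.single j 1)
        + h 0 (imL n (fderiv ℝ (fderiv ℝ Z) (0, y) (1, 0) (0, Pi.single i 1))) (Pi.single j 1)
        + h 0 (Pi.single i 1) (imL n (fderiv ℝ (fderiv ℝ Z) (0, y) (1, 0) (0, Pi.single j 1)))) (by
      rw [hm0, add_mul, add_mul, Matrix.mul_assoc (m * P.transpose), Matrix.nonsing_inv_mul _ hmu,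
        Matrix.mul_one, ← Matrix.transpose_transpose (m * P.transpose), Matrix.transpose_mul,
        Matrix.transpose_transpose, hmT, Matrix.smul_mul]
      ext i j
      simp only [Matrix.add_apply, Matrix.smul_apply, Matrix.transpose_apply, Matrix.of_apply, hP,
        hB, hm, gram_mul_apply, hT, H.metric_christoffel, H.symm 0 (Pi.single i 1)]
      simp)
  have h2 := h1.sqrt (by rw [hm0]; exact hpos.ne')
  refine h2.congr_deriv ?_
  have htr : ((2 : ℝ) • B + P + m * P.transpose * m⁻¹).trace = 2 * traceCLM n T := by
    have hBt : B.trace = 0 := by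
      have h3 : B.trace = traceCLM n (christoffel h 0 ξ) := by
        simp [hB, Matrix.trace, traceCLM_apply]
      rw [h3, ← H.fderiv_logDensity, hcrit, zero_apply]
    have hPt : P.trace = traceCLM n T := by simp [hP, Matrix.trace, traceCLM_apply]
    rw [Matrix.trace_add, Matrix.trace_add, Matrix.trace_smul, hBt, Matrix.trace_mul_comm,
      ← Matrix.mul_assoc, Matrix.nonsing_inv_mul _ hmu, Matrix.one_mul, Matrix.trace_transpose, hPt]
    simp
    ring
  rw [htr, hm0]
  have h4 := Real.mul_self_sqrt hpos.le
  have h5 : Real.sqrt m.det ≠ 0 := (Real.sqrt_pos.2 hpos).ne'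
  rw [div_eq_iff (mul_ne_zero two_ne_zero h5)]
  linear_combination (-2 * (traceCLM n) T) * h4

/-- After differentiation under the integral only the divergence of η is left. Translation by a
period changes Z by a constant, so η is periodic and the integral vanishes. -/
theorem hasDerivAt_integral_sqrt_det_gramAlong (hZ0 : ∀ y, Z (0, y) = ofImagL n y)
    {O : Set (ℝ × (Fin n → ℝ))} (hO : IsOpen O) (hO0 : ∀ y, ((0 : ℝ), y) ∈ O)
    (hZ : ∀ w ∈ O, ContDiffAt ℝ 3 Z w)
    (hper : ∀ (t : ℝ) (y : Fin n → ℝ) (k : Fin n → ℤ),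
      Z (t, fun i => y i + 2 * Real.pi * (k i : ℝ)) =
        Z (t, y) + ofImagL n (fun i => 2 * Real.pi * (k i : ℝ)))
    (hcrit : fderiv ℝ (logDensity h) 0 = 0) :
    HasDerivAt (fun t => ∫ y in Set.Icc (0 : Fin n → ℝ) (fun _ => 2 * Real.pi),
      Real.sqrt (gramAlong h Z (t, y)).det) 0 0 := by
  have hm : ∀ w ∈ O, ContDiffAt ℝ 1 (fun w => (gramAlong h Z w).det) w := fun w hw => by
    have h1 : ContDiffAt ℝ 1 (fderiv ℝ Z) w := (hZ w hw).fderiv_right (by norm_num)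
    have h2 : ContDiffAt ℝ 1 (fun w => tubeMetric h (Z w)) w :=
      (H.contDiff_tubeMetric.contDiffAt.of_le
        (WithTop.coe_le_coe.2 (le_top (a := (1 : ℕ∞))))).comp w ((hZ w hw).of_le (by norm_num))
    refine (detRows n).contDiff.contDiffAt.comp w
      (contDiffAt_pi.2 fun i => contDiffAt_pi.2 fun j => ?_)
    exact (h2.clm_apply (h1.clm_apply contDiffAt_const)).clm_apply (h1.clm_apply contDiffAt_const)
  have hpos : 0 < (gram (h 0)).det := (posDef_gram (H.symm 0) (H.pos 0)).det_pos
  have hm0 : ∀ y, (gramAlong h Z (0, y)).det = (gram (h 0)).det := fun y => by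
    rw [H.gramAlong_zero hZ0 ((hZ _ (hO0 y)).differentiableAt (by norm_num))]
  -- The square root is differentiable only away from zero determinant, so the domain is shrunk
  -- accordingly.
  have hO' : IsOpen (O ∩ (fun w => (gramAlong h Z w).det) ⁻¹' {0}ᶜ) :=
    ContinuousOn.isOpen_inter_preimage
      (fun w hw => (hm w hw).continuousAt.continuousWithinAt) hO isOpen_compl_singleton
  have h1 := hasDerivAt_setIntegral_of_contDiffAt (S := fun w => Real.sqrt (gramAlong h Z w).det)
    volume (isCompact_Icc (a := (0 : Fin n → ℝ)) (b := fun _ => 2 * Real.pi)) hO'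
    (fun y _ => ⟨hO0 y, by simpa [hm0] using hpos.ne'⟩) (fun w hw => (hm w hw.1).sqrt hw.2)
  refine h1.congr_deriv ?_
  set η : (Fin n → ℝ) → (Fin n → ℝ) := fun y => imL n (fderiv ℝ Z (0, y) (1, 0)) with hη
  have h2 : ∀ y, fderiv ℝ (fun w => Real.sqrt (gramAlong h Z w).det) (0, y) (1, 0) =
      Real.sqrt (gram (h 0)).det * traceCLM n (fderiv ℝ η y) := fun y => by
    have h3 := H.hasDerivAt_sqrt_det_gramAlong hZ0 ((hZ _ (hO0 y)).of_le (by norm_num)) hcrit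
    have hl : HasDerivAt (fun s : ℝ => (s, y)) ((1 : ℝ), (0 : Fin n → ℝ)) 0 :=
      (hasDerivAt_id (0 : ℝ)).prodMk (hasDerivAt_const (0 : ℝ) y)
    have h4 : DifferentiableAt ℝ (fun w => Real.sqrt (gramAlong h Z w).det) (0, y) :=
      ((hm _ (hO0 y)).sqrt (by rw [hm0]; exact hpos.ne')).differentiableAt (by norm_num)
    have h5 := HasFDerivAt.comp_hasDerivAt (f := fun s : ℝ => (s, y)) 0 h4.hasFDerivAt hl
    exact h5.unique h3
  simp only [h2]
  rw [integral_const_mul, integral_trace_fderiv_eq_zero, mul_zero]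
  · refine (imL n).contDiff.comp (contDiff_iff_contDiffAt.2 fun y => ?_)
    have h3 : ContDiffAt ℝ 1 (fderiv ℝ Z) (0, y) := (hZ _ (hO0 y)).fderiv_right (by norm_num)
    have h4 : ContDiffAt ℝ 1 (fun y : Fin n → ℝ => fderiv ℝ Z (0, y)) y :=
      h3.comp (f := fun y : Fin n → ℝ => ((0 : ℝ), y)) y (contDiffAt_const.prodMk contDiffAt_id)
    exact h4.clm_apply contDiffAt_const
  · intro y k
    set c : Fin n → ℝ := fun i => 2 * Real.pi * (k i : ℝ) with hc
    have h3 : (fun w : ℝ × (Fin n → ℝ) => Z (w + (0, c))) = fun w => Z w + ofImagL n c := by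
      funext w
      rw [← hper]
      congr 1
      ext <;> simp [hc]
    have h4 := congrArg (fun F => fderiv ℝ F (0, y)) h3
    simp only [fderiv_comp_add_right, fderiv_add_const] at h4
    rw [hη]
    simp only
    have h5 : ((0 : ℝ), fun i => y i + 2 * Real.pi * (k i : ℝ)) = (0, y) + (0, c) := by
      ext <;> simp [hc]
    rw [← h4, h5]

end IsHessianMetric

variable {M : Type*} [TopologicalSpace M] [ChartedSpace (Cn n) M]
  [MulAction (ComplexTorus n) M] [IsManifold 𝓘(ℂ, Cn n) ω M]

/-- An orbit in the open orbit at which the volume is critical among the orbits is minimal. -/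
theorem IsMomentMap.isMinimalTorus [T2Space M] {g : RiemMetric n M}
    {μ : M → ((Fin n → ℝ) →L[ℝ] ℝ)} (hμ : IsMomentMap g μ) (hM : IsToric n M) (hg : IsKahler g)
    {p : M} (hp : IsOpen (MulAction.orbit (ComplexTorus n) p))
    (hcrit : fderiv ℝ (logDensity (orbitMetric μ p)) 0 = 0) :
    IsMinimalTorus g (orbitMap (n := n) p) := by
  intro Φ hΦ hper hΦ0
  have H := hμ.isHessianMetric hM hg hp
  obtain ⟨L, hL1, hL2, hL3⟩ := hM.exists_local_inverse (z := 0)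
    fun u => hM.diffAt_expOrbit_injective hp
  rw [expOrbit_zero] at hL1 hL2 hL3
  obtain ⟨U, hU, hUo, hpU⟩ := mem_nhds_iff.1
    ((((contMDiffAt_iff_contMDiffAt_nhds (by decide)).1 hL2).and hL3))
  -- Undoing the rotation by y collapses the torus at t = 0 to the point p. A single local inverse L
  -- near p then suffices, and adding iy back gives a lift Z defined along all of ℝⁿ, with no
  -- monodromy argument.
  set Ψ : ℝ × (Fin n → ℝ) → M := fun w => expOrbit (Φ w) (-ofImagL n w.2) with hΨ
  have hΨs : ContMDiff 𝓘(ℝ, ℝ × (Fin n → ℝ)) 𝓘(ℝ, Cn n) ∞ Ψ :=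
    hM.contMDiff_action.comp
      (((ofImagL n).contDiff.comp contDiff_snd).neg.contMDiff.prodMk hΦ)
  have hΨ0 : ∀ y, Ψ (0, y) = p := fun y => by
    simp only [hΨ, hΦ0, orbitMap_eq]
    rw [← expOrbit_add, add_neg_cancel, expOrbit_zero]
  have hΨΦ : ∀ w, expOrbit (Ψ w) (ofImagL n w.2) = Φ w := fun w => by
    rw [hΨ]
    simp only
    rw [← expOrbit_add, neg_add_cancel, expOrbit_zero]
  set O := Ψ ⁻¹' U with hO
  have hOo : IsOpen O := hUo.preimage hΨs.continuous
  have hO0 : ∀ y, ((0 : ℝ), y) ∈ O := fun y => by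
    change Ψ (0, y) ∈ U
    rw [hΨ0]
    exact hpU
  set Z : ℝ × (Fin n → ℝ) → Cn n := fun w => L (Ψ w) + ofImagL n w.2 with hZ
  have hZ0 : ∀ y, Z (0, y) = ofImagL n y := fun y => by simp [hZ, hΨ0, hL1]
  have hZs : ∀ w ∈ O, ContDiffAt ℝ 3 Z w := fun w hw => by
    refine ContDiffAt.add ?_ ((ofImagL n).contDiff.comp contDiff_snd).contDiffAt
    rw [← contMDiffAt_iff_contDiffAt]
    exact (hU hw).1.comp w ((hΨs w).of_le (WithTop.coe_le_coe.2 (le_top (a := (3 : ℕ∞)))))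
  have hZΦ : ∀ w ∈ O, Φ w = expOrbit p (Z w) := fun w hw => by
    have h1 : expOrbit p (L (Ψ w)) = Ψ w := (hU hw).2
    rw [hZ]
    simp only
    rw [expOrbit_add, h1, hΨΦ]
  have hZper : ∀ (t : ℝ) (y : Fin n → ℝ) (k : Fin n → ℤ),
      Z (t, fun i => y i + 2 * Real.pi * (k i : ℝ)) =
        Z (t, y) + ofImagL n (fun i => 2 * Real.pi * (k i : ℝ)) := by
    intro t y k
    set c : Fin n → ℝ := fun i => 2 * Real.pi * (k i : ℝ) with hc
    have h1 : (fun i => y i + 2 * Real.pi * (k i : ℝ)) = y + c := rfl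
    have h2 : Φ (t, y + c) = Φ (t, y) := hper t y k
    have h3 : ∀ q : M, expOrbit q (-ofImagL n c) = q := fun q => by
      have h4 : torusExp (-ofImagL n c) = 1 := by
        ext i
        simp only [torusExp, Units.val_mk0, Pi.neg_apply, ofImagL_apply, Pi.one_apply,
          Units.val_one]
        refine Complex.exp_eq_one_iff.2 ⟨-k i, ?_⟩
        simp [hc]
        ring
      rw [expOrbit, h4, one_smul]
    have h5 : Ψ (t, y + c) = Ψ (t, y) := by
      rw [hΨ]
      simp only
      rw [h2, map_add, neg_add, expOrbit_add, h3]
    rw [h1, hZ]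
    simp only
    rw [h5, map_add, add_assoc]
  refine (H.hasDerivAt_integral_sqrt_det_gramAlong hZ0 hOo hO0 hZs hZper
    hcrit).congr_of_eventuallyEq ?_
  -- For small t the whole period cell stays where the lift is valid, so the torus volume equals the
  -- integral over the lift.
  obtain ⟨u, v, hu, -, hu0, hKv, huv⟩ := generalized_tube_lemma (s := {(0 : ℝ)})
    (t := Set.Icc (0 : Fin n → ℝ) (fun _ => 2 * Real.pi)) isCompact_singleton isCompact_Icc hOo (by
      rintro ⟨t, y⟩ ⟨ht, hy⟩
      obtain rfl : t = 0 := ht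
      exact hO0 y)
  filter_upwards [hu.mem_nhds (hu0 rfl)] with t ht
  refine setIntegral_congr_fun measurableSet_Icc fun y hy => ?_
  have hw : (t, y) ∈ O := huv ⟨ht, hKv hy⟩
  have h1 : HasFDerivAt (fun y : Fin n → ℝ => (t, y))
      (ContinuousLinearMap.inr ℝ ℝ (Fin n → ℝ)) y := hasFDerivAt_prodMk_right t y
  have h2 : HasFDerivAt (fun y => Z (t, y)) _ y :=
    HasFDerivAt.comp (g := Z) (f := fun y : Fin n → ℝ => (t, y)) y
    ((hZs _ hw).differentiableAt (by norm_num)).hasFDerivAt h1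
  have h3 : (fun y => Φ (t, y)) =ᶠ[𝓝 y] fun y => expOrbit p (Z (t, y)) := by
    have : ∀ᶠ y' in 𝓝 y, (t, y') ∈ O :=
      h1.continuousAt.eventually (hOo.mem_nhds hw)
    exact this.mono fun y' hy' => hZΦ _ hy'
  have h4 := pullbackMetric_comp g (F := expOrbit (n := n) p) h3 (hM.mdifferentiable_expOrbit p _)
    h2.differentiableAt
  rw [hμ.pullbackMetric_expOrbit hM hg, h2.fderiv] at h4
  simp only [h4]
  rfl

end FirstVariation

/-! ### The main theorem. -/

theorem mainTheorem1 (n : ℕ) {M : Type*} [TopologicalSpace M] [T2Space M]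
    [ChartedSpace (Cn n) M] [IsManifold 𝓘(ℂ, Cn n) ω M]
    [MulAction (ComplexTorus n) M] (hM : IsToric n M)
    (g : RiemMetric n M) (hg : IsKahler g) (hH : IsHamiltonian g)
    (p₀ : M) (hp₀ : IsOpen (MulAction.orbit (ComplexTorus n) p₀)) :
    -- `Vol` is a smooth positive function on the space of orbits in the open orbit
    (ContDiff ℝ ∞ (orbitVolume g p₀) ∧ ∀ x, 0 < orbitVolume g p₀ x) ∧
    -- `Ric > 0`
    (RicciPositiveOn g (MulAction.orbit (ComplexTorus n) p₀) ↔
      HessStrictlyConcave fun x => Real.log (orbitVolume g p₀ x)) ∧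
    (RicciPositiveOn g (MulAction.orbit (ComplexTorus n) p₀) →
      HessStrictlyConvex (fun x => 1 / orbitVolume g p₀ x) ∧
      (CompactSpace M →
        ∃ x₀ : Fin n → ℝ,
          (∀ x, fderiv ℝ (orbitVolume g p₀) x = 0 ↔ x = x₀) ∧
          (∀ p : M, torusVolume g (orbitMap p) ≤ orbitVolume g p₀ x₀) ∧
          IsLagrangianTorus g (orbitMap (expReal x₀ • p₀)) ∧
          IsMinimalTorus g (orbitMap (expReal x₀ • p₀)))) ∧
    -- `Ric < 0`
    (RicciNegativeOn g (MulAction.orbit (ComplexTorus n) p₀) ↔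
      HessStrictlyConvex fun x => Real.log (orbitVolume g p₀ x)) ∧
    (RicciNegativeOn g (MulAction.orbit (ComplexTorus n) p₀) →
      HessStrictlyConvex (orbitVolume g p₀) ∧ (0 < n → ¬ CompactSpace M)) := by
  obtain ⟨μ, hμ⟩ := hH
  have hpos := hμ.orbitVolume_pos hM hg hp₀
  have hP := hμ.ricciPositiveOn_iff hM hg hp₀
  have hN := hμ.ricciNegativeOn_iff hM hg hp₀
  have hl := hμ.contDiff_two_logDensity hM hg hp₀
  refine ⟨⟨hμ.contDiff_orbitVolume hM hg hp₀, hpos⟩, hP, fun h => ?_, hN, fun h => ?_⟩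
  · have h1 := (hP.1 h).2
    rw [hμ.fderiv_fderiv_log_orbitVolume hM hg hp₀] at h1
    refine ⟨hμ.hessStrictlyConvex_one_div_orbitVolume hM hg hp₀ h1, fun hc => ?_⟩
    obtain ⟨x₀, hx₀, hmax⟩ := hμ.exists_forall_logDensity_le hM hg hp₀
    have hcrit : fderiv ℝ (logDensity (orbitMetric μ p₀)) x₀ = 0 :=
      IsLocalMax.fderiv_eq_zero (Filter.Eventually.of_forall hmax)
    have hp : IsOpen (MulAction.orbit (ComplexTorus n) (expReal x₀ • p₀)) := by
      rwa [MulAction.orbit_smul]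
    refine ⟨x₀, fun x => ?_, hx₀, hμ.isLagrangianTorus hM hg hp,
      hμ.isMinimalTorus hM hg hp ?_⟩
    · rw [hμ.fderiv_orbitVolume_eq_zero_iff hM hg hp₀]
      exact ⟨fun hx => eq_of_fderiv_eq_zero_of_hess_neg hl h1 hx hcrit, fun hx => hx ▸ hcrit⟩
    -- Moving the base point to the critical orbit translates the density by `x₀`, so criticality at
    -- `x₀` becomes criticality at 0.
    · have h2 : logDensity (orbitMetric μ (expReal x₀ • p₀)) =
          fun x => logDensity (orbitMetric μ p₀) (x₀ + x) := by
        funext x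
        have h3 := hμ.orbitMetric_expOrbit p₀ (ofRealL n x₀) x
        rw [reL_ofRealL] at h3
        rw [logDensity, logDensity, ← h3]
        rfl
      rw [h2, fderiv_comp_add_left, add_zero, hcrit]
  · have h1 := (hN.1 h).2
    rw [hμ.fderiv_fderiv_log_orbitVolume hM hg hp₀] at h1
    refine ⟨hμ.hessStrictlyConvex_orbitVolume hM hg hp₀ h1, fun hn hc => ?_⟩
    obtain ⟨x₀, -, hmax⟩ := hμ.exists_forall_logDensity_le hM hg hp₀
    obtain ⟨x, hx⟩ := exists_lt_of_hess_pos hl h1 hn x₀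
    exact absurd hx (not_lt.2 (hmax x))
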